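/- Let $K$ be a field, $\Gamma$ a finite quiver, and $K\Gamma$ its path algebra, graded by path length; let $J$ be the two-sided ideal generated by the arrows. For a homogeneous ideal $I\subseteq J^2$ put $\Lambda=K\Gamma/I$ with the induced grading and let $\Lambda_0=\Lambda/(J/I)$, a graded left $\Lambda$-module concentrated in degree $0$. Let $$\cdots\to P^2\to P^1\to P^0\to\Lambda_0\to 0$$ be a minimal graded projective resolution: every $P^n$ is a graded projective left $\Lambda$-module, all maps have degree $0$, the sequence is exact, and for $n\ge 1$ the image of $P^n$ in $P^{n-1}$ is contained in $(J/I)P^{n-1}$. For an integer $d\ge 2$ define $\delta\colon\mathbb N\to\mathbb N$ by $\delta(n)=\frac n2 d$ if $n$ is even and $\delta(n)=\frac{n-1}{2}d+1$ if $n$ is odd. The algebra $\Lambda$ is called *$d$-Koszul* if, for every $n\ge 0$, $P^n$ can be generated in degree $\delta(n)$. It is called *$2$-$d$-determined* if $I$ can be generated by homogeneous elements of degrees $2$ and $d$ and, for every $n\ge0$, $P^n$ can be generated in degrees at least $n$ and at most $\delta(n)$. **Theorem.** Let $d>2$ be an integer, let $I$ be an ideal of $K\Gamma$ generated by paths, and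 let $\mathcal G$ be its minimal generating set of paths. Assume that every path in $\mathcal G$ has length $2$ or $d$, and let $\mathcal G_d$ be the set of paths of length $d$ in $\mathcal G$. Then $K\Gamma/I$ is $2$-$d$-determined if and only if $K\Gamma/\langle\mathcal G_d\rangle$ is $d$-Koszul. -/

import Mathlib

universe u v w

noncomputable section

/-! ### Paths and the path algebra -/

/-- The set `𝓑` of all directed paths of a quiver (with arbitrary endpoints). Paths of length `0`
are the vertices. -/
abbrev QPath (V : Type v) [Quiver.{w} V] : Type (max v w) :=
  Σ a b : V, Quiver.Path a b

/-- The path algebra `KΓ` of the quiver on `V`: the `K`-vector space with basis the set of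
all paths. -/
def PathAlgebra (K : Type u) (V : Type v) [Field K] [Quiver.{w} V] : Type (max u v w) :=
  QPath V →₀ K

namespace PathAlgebra

section Basic

variable {K : Type u} {V : Type v} [Field K] [Quiver.{w} V]

instance : AddCommGroup (PathAlgebra K V) := inferInstanceAs (AddCommGroup (QPath V →₀ K))

instance : Module K (PathAlgebra K V) := inferInstanceAs (Module K (QPath V →₀ K))

/-- The length `ℓ(p)` of a path. -/
def len (p : QPath V) : ℕ := p.2.2.length

variable (K) in
/-- The basis element of `KΓ` given by a path. -/
def ofPath (p : QPath V) : PathAlgebra K V := Finsupp.single p (1 : K)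

open Classical in
variable (K) in
/-- The product of two paths in `KΓ`: the concatenation `pq` (first `p`, then `q`) if `p` ends
where `q` starts, and `0` otherwise. -/
def pathMul (p q : QPath V) : PathAlgebra K V :=
  if h : p.2.1 = q.1 then ofPath K ⟨p.1, q.2.1, p.2.2.comp (q.2.2.cast h.symm rfl)⟩ else 0

/-- The linear map out of `KΓ` with prescribed values on the basis of paths. -/
def lift {M : Type*} [AddCommGroup M] [Module K M] (f : QPath V → M) : PathAlgebra K V →ₗ[K] M :=
  Finsupp.linearCombination K f

theorem lift_ofPath {M : Type*} [AddCommGroup M] [Module K M] (f : QPath V → M) (p : QPath V) :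
    lift f (ofPath K p) = f p :=
  (Finsupp.linearCombination_single K (1 : K) p).trans (one_smul K (f p))

/-- The multiplication of `KΓ`: the bilinear extension of the product of paths. -/
def mulBilin : PathAlgebra K V →ₗ[K] PathAlgebra K V →ₗ[K] PathAlgebra K V :=
  lift fun p => lift fun q => pathMul K p q

instance : Mul (PathAlgebra K V) := ⟨fun f g => mulBilin f g⟩

/-- The unit of `KΓ`: the sum of all vertices. -/
instance [Fintype V] : One (PathAlgebra K V) := ⟨∑ a : V, ofPath K ⟨a, a, Quiver.Path.nil⟩⟩

theorem mul_def (f g : PathAlgebra K V) : f * g = mulBilin f g := rfl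

theorem one_def [Fintype V] :
    (1 : PathAlgebra K V) = ∑ a : V, ofPath K ⟨a, a, Quiver.Path.nil⟩ := rfl

theorem ofPath_mul_ofPath (p q : QPath V) : ofPath K p * ofPath K q = pathMul K p q := by
  rw [mul_def, mulBilin, lift_ofPath, lift_ofPath]

theorem pathMul_comp {a b c : V} (p : Quiver.Path a b) (q : Quiver.Path b c) :
    pathMul K ⟨a, b, p⟩ ⟨b, c, q⟩ = ofPath K ⟨a, c, p.comp q⟩ := by
  simp [pathMul]

theorem pathMul_of_ne {p q : QPath V} (h : p.2.1 ≠ q.1) : pathMul K p q = 0 := by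
  simp [pathMul, h]

theorem induction_on {P : PathAlgebra K V → Prop} (f : PathAlgebra K V) (h0 : P 0)
    (hadd : ∀ f g, P f → P g → P (f + g)) (hs : ∀ (c : K) (p : QPath V), P (c • ofPath K p)) :
    P f := by
  refine Finsupp.induction_linear (motive := P) f h0 hadd fun p c => ?_
  have : (Finsupp.single p c : QPath V →₀ K) = c • Finsupp.single p (1 : K) := by simp
  exact this ▸ hs c p

protected theorem smul_mul (c : K) (f g : PathAlgebra K V) : (c • f) * g = c • (f * g) := by
  simp [mul_def]

protected theorem mul_smul' (c : K) (f g : PathAlgebra K V) : f * (c • g) = c • (f * g) := by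
  simp [mul_def]

protected theorem add_mul' (f g h : PathAlgebra K V) : (f + g) * h = f * h + g * h := by
  simp [mul_def]

protected theorem mul_add' (f g h : PathAlgebra K V) : f * (g + h) = f * g + f * h := by
  simp [mul_def]

protected theorem zero_mul' (f : PathAlgebra K V) : 0 * f = 0 := by simp [mul_def]

protected theorem mul_zero' (f : PathAlgebra K V) : f * 0 = 0 := by simp [mul_def]

theorem ofPath_mul_assoc (p q r : QPath V) :
    ofPath K p * ofPath K q * ofPath K r = ofPath K p * (ofPath K q * ofPath K r) := by
  obtain ⟨a, b, p⟩ := p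
  obtain ⟨b', c, q⟩ := q
  obtain ⟨c', d, r⟩ := r
  simp only [ofPath_mul_ofPath]
  by_cases hb : b = b'
  · subst hb
    by_cases hc : c = c'
    · subst hc
      simp only [pathMul_comp, ofPath_mul_ofPath, Quiver.Path.comp_assoc]
    · rw [pathMul_comp, ofPath_mul_ofPath, pathMul_of_ne (p := ⟨a, c, _⟩) hc,
        pathMul_of_ne (p := ⟨b, c, q⟩) hc, PathAlgebra.mul_zero']
  · rw [pathMul_of_ne (p := ⟨a, b, p⟩) hb, PathAlgebra.zero_mul']
    by_cases hc : c = c'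
    · subst hc
      rw [pathMul_comp, ofPath_mul_ofPath, pathMul_of_ne (p := ⟨a, b, p⟩) hb]
    · rw [pathMul_of_ne (p := ⟨b', c, q⟩) hc, PathAlgebra.mul_zero']

protected theorem mul_assoc' (f g h : PathAlgebra K V) : f * g * h = f * (g * h) := by
  refine induction_on (P := fun f => f * g * h = f * (g * h)) f ?_ ?_ fun c p => ?_
  · simp only [PathAlgebra.zero_mul']
  · intro f₁ f₂ h₁ h₂
    simp only [PathAlgebra.add_mul', h₁, h₂]
  refine induction_on (P := fun g => _ * g * h = _ * (g * h)) g ?_ ?_ fun c' q => ?_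
  · simp only [PathAlgebra.zero_mul', PathAlgebra.mul_zero']
  · intro f₁ f₂ h₁ h₂
    simp only [PathAlgebra.add_mul', PathAlgebra.mul_add', h₁, h₂]
  refine induction_on (P := fun h => _ * _ * h = _ * (_ * h)) h ?_ ?_ fun c'' r => ?_
  · simp only [PathAlgebra.mul_zero']
  · intro f₁ f₂ h₁ h₂
    simp only [PathAlgebra.mul_add', h₁, h₂]
  simp only [PathAlgebra.smul_mul, PathAlgebra.mul_smul', ofPath_mul_assoc]

theorem sum_mul' {ι : Type*} (s : Finset ι) (f : ι → PathAlgebra K V) (g : PathAlgebra K V) :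
    (∑ i ∈ s, f i) * g = ∑ i ∈ s, f i * g := by
  simp [mul_def]

theorem mul_sum' {ι : Type*} (s : Finset ι) (f : ι → PathAlgebra K V) (g : PathAlgebra K V) :
    g * (∑ i ∈ s, f i) = ∑ i ∈ s, g * f i := by
  simp [mul_def]

protected theorem one_mul' [Fintype V] (f : PathAlgebra K V) : 1 * f = f := by
  refine induction_on (P := fun f => 1 * f = f) f ?_ ?_ fun c p => ?_
  · simp only [PathAlgebra.mul_zero']
  · intro f₁ f₂ h₁ h₂
    simp only [PathAlgebra.mul_add', h₁, h₂]
  obtain ⟨a, b, p⟩ := p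
  rw [PathAlgebra.mul_smul', one_def, sum_mul', Finset.sum_eq_single a]
  · rw [ofPath_mul_ofPath, pathMul_comp, Quiver.Path.nil_comp]
  · intro a' _ h
    rw [ofPath_mul_ofPath, pathMul_of_ne]
    exact h
  · intro h
    exact absurd (Finset.mem_univ a) h

protected theorem mul_one' [Fintype V] (f : PathAlgebra K V) : f * 1 = f := by
  refine induction_on (P := fun f => f * 1 = f) f ?_ ?_ fun c p => ?_
  · simp only [PathAlgebra.zero_mul']
  · intro f₁ f₂ h₁ h₂
    simp only [PathAlgebra.add_mul', h₁, h₂]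
  obtain ⟨a, b, p⟩ := p
  rw [PathAlgebra.smul_mul, one_def, mul_sum', Finset.sum_eq_single b]
  · rw [ofPath_mul_ofPath, pathMul_comp, Quiver.Path.comp_nil]
  · intro b' _ h
    rw [ofPath_mul_ofPath, pathMul_of_ne]
    exact fun e => h e.symm
  · intro h
    exact absurd (Finset.mem_univ b) h

instance [Fintype V] : Ring (PathAlgebra K V) :=
  { (inferInstance : AddCommGroup (PathAlgebra K V)) with
    mul := (· * ·)
    one := 1
    left_distrib := PathAlgebra.mul_add'
    right_distrib := PathAlgebra.add_mul'
    zero_mul := PathAlgebra.zero_mul'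
    mul_zero := PathAlgebra.mul_zero'
    mul_assoc := PathAlgebra.mul_assoc'
    one_mul := PathAlgebra.one_mul'
    mul_one := PathAlgebra.mul_one' }

instance [Fintype V] : Algebra K (PathAlgebra K V) :=
  Algebra.ofModule PathAlgebra.smul_mul PathAlgebra.mul_smul'

variable (K V) in
/-- The homogeneous component `(KΓ)ₙ`: the span of the paths of length `n`. -/
def homog (n : ℕ) : Submodule K (PathAlgebra K V) :=
  Submodule.span K (ofPath K '' {p : QPath V | len p = n})

variable (K) in
/-- The two-sided ideal of `KΓ` generated by a set of paths. -/
def monomialIdeal [Fintype V] (S : Set (QPath V)) : TwoSidedIdeal (PathAlgebra K V) :=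
  TwoSidedIdeal.span (ofPath K '' S)

variable (K V) in
/-- The two-sided ideal `J` of `KΓ` generated by the arrows. -/
def arrowIdeal [Fintype V] : TwoSidedIdeal (PathAlgebra K V) :=
  monomialIdeal K {p : QPath V | len p = 1}

end Basic

end PathAlgebra

/-! ### Graded modules and minimal graded projective resolutions -/

/-- A `ℤ`-graded left module over a ring `A` with an `ℕ`-indexed family `𝒜` of homogeneous
components. -/
structure GradedMod {A : Type u} [Ring A] (𝒜 : ℕ → AddSubgroup A) where
  carrier : Type u
  [addCommGroup : AddCommGroup carrier]
  [module : Module A carrier]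
  /-- The homogeneous components. -/
  deg : ℤ → AddSubgroup carrier
  isInternal : DirectSum.IsInternal deg
  smul_mem : ∀ {i : ℕ} {j : ℤ} {a : A} {x : carrier},
    a ∈ 𝒜 i → x ∈ deg j → a • x ∈ deg ((i : ℤ) + j)

namespace GradedMod

variable {A : Type u} [Ring A] {𝒜 : ℕ → AddSubgroup A}

instance : CoeSort (GradedMod 𝒜) (Type u) := ⟨GradedMod.carrier⟩

instance (M : GradedMod 𝒜) : AddCommGroup M := M.addCommGroup

instance (M : GradedMod 𝒜) : Module A M := M.module

theorem isInternal_concentrated (N : Type*) [AddCommGroup N] :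
    DirectSum.IsInternal fun i : ℤ => if i = 0 then (⊤ : AddSubgroup N) else ⊥ := by
  set S : ℤ → AddSubgroup N := fun i => if i = 0 then ⊤ else ⊥ with hS
  have hz : ∀ i, i ≠ 0 → ∀ y : S i, (y : N) = 0 := by
    rintro i hi ⟨y, hy⟩
    simpa [hS, hi] using hy
  have key : ∀ y : DirectSum ℤ fun i => S i, DirectSum.coeAddMonoidHom S y = (y 0 : N) := by
    intro y
    induction y using DirectSum.induction_on with
    | zero => simp
    | of i y =>
      rw [DirectSum.coeAddMonoidHom_of]
      by_cases hi : i = 0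
      · subst hi
        rw [DirectSum.of_eq_same]
      · rw [DirectSum.of_eq_of_ne _ _ _ (Ne.symm hi), hz i hi y]
        rfl
    | add y z hy hz => rw [map_add, hy, hz]; rfl
  constructor
  · rw [injective_iff_map_eq_zero]
    intro x hx
    refine DFinsupp.ext fun i => Subtype.ext ?_
    by_cases hi : i = 0
    · subst hi
      exact (key x).symm.trans hx
    · exact hz i hi _
  · intro y
    exact ⟨DirectSum.of (fun i => S i) 0 ⟨y, by simp [hS]⟩, DirectSum.coeAddMonoidHom_of _ _ _⟩

/-- The graded module `M` can be generated by homogeneous elements with degrees in `D`. -/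
def GeneratedInDegrees (M : GradedMod 𝒜) (D : Set ℤ) : Prop :=
  Submodule.span A (⋃ i ∈ D, (M.deg i : Set M)) = ⊤

end GradedMod

/-- A minimal graded projective resolution `⋯ → P² → P¹ → P⁰ → M → 0` of the graded module `M`:
every `Pⁿ` is a graded projective module, all maps have degree `0`, the sequence is exact, and the
image of `Pⁿ⁺¹` in `Pⁿ` lies in `J Pⁿ`, where `J` is the graded Jacobson radical of the ring. -/
structure MinimalGradedProjectiveResolution {A : Type u} [Ring A] {𝒜 : ℕ → AddSubgroup A}
    (J : Ideal A) (M : GradedMod 𝒜) where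
  P : ℕ → GradedMod 𝒜
  projective : ∀ n, Module.Projective A (P n)
  d : ∀ n, P (n + 1) →ₗ[A] P n
  ε : P 0 →ₗ[A] M
  d_deg : ∀ n (i : ℤ), ∀ x ∈ (P (n + 1)).deg i, d n x ∈ (P n).deg i
  ε_deg : ∀ i : ℤ, ∀ x ∈ (P 0).deg i, ε x ∈ M.deg i
  ε_surjective : Function.Surjective ε
  exact_zero : Function.Exact (d 0) ε
  exact_succ : ∀ n, Function.Exact (d (n + 1)) (d n)
  minimal : ∀ n, LinearMap.range (d n) ≤ J • (⊤ : Submodule A (P n))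

/-! ### Quotients of path algebras -/

namespace PathAlgebra

variable {K : Type u} {V : Type v} [Field K] [Quiver.{w} V] [Fintype V]

/-- The algebra `Λ = KΓ/I`. -/
abbrev Quot (I : TwoSidedIdeal (PathAlgebra K V)) : Type (max u v w) := I.ringCon.Quotient

/-- The quotient map `KΓ → KΓ/I`. -/
def Quot.mk (I : TwoSidedIdeal (PathAlgebra K V)) : PathAlgebra K V →+* Quot I := I.ringCon.mk'

/-- The components of the induced length grading of `Λ = KΓ/I` (a grading if `I` is
homogeneous). -/
def Quot.homog (I : TwoSidedIdeal (PathAlgebra K V)) (n : ℕ) : AddSubgroup (Quot I) :=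
  (PathAlgebra.homog K V n).toAddSubgroup.map (Quot.mk I).toAddMonoidHom

/-- The ideal of `Λ = KΓ/I` which is the image of `J`; it is `J/I` if `I ⊆ J`. -/
def Quot.radical (I : TwoSidedIdeal (PathAlgebra K V)) : Ideal (Quot I) :=
  Ideal.map (Quot.mk I) (TwoSidedIdeal.asIdeal (arrowIdeal K V))

theorem Quot.mk_surjective (I : TwoSidedIdeal (PathAlgebra K V)) :
    Function.Surjective (Quot.mk I) := RingCon.mk'_surjective _

theorem Quot.mul_mem_radical_right (I : TwoSidedIdeal (PathAlgebra K V)) {a b : Quot I}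
    (ha : a ∈ Quot.radical I) : a * b ∈ Quot.radical I := by
  obtain ⟨b, rfl⟩ := Quot.mk_surjective I b
  refine Submodule.span_induction (p := fun x _ => x * Quot.mk I b ∈ Quot.radical I)
    ?_ ?_ ?_ ?_ ha
  · rintro _ ⟨x, hx, rfl⟩
    rw [← map_mul]
    exact Ideal.mem_map_of_mem _ (TwoSidedIdeal.mul_mem_right _ _ _ hx)
  · simp
  · intro x y _ _ hx hy
    rw [add_mul]
    exact add_mem hx hy
  · intro c x _ hx
    rw [smul_eq_mul, mul_assoc]
    exact Ideal.mul_mem_left _ _ hx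

theorem ofPath_mem_arrowIdeal {p : QPath V} (hp : len p ≠ 0) : ofPath K p ∈ arrowIdeal K V := by
  obtain ⟨a, b, p⟩ := p
  cases p with
  | nil => exact absurd rfl hp
  | cons q e =>
    change ofPath K ⟨a, b, q.comp e.toPath⟩ ∈ _
    rw [← pathMul_comp, ← ofPath_mul_ofPath]
    exact TwoSidedIdeal.mul_mem_left _ _ _ (TwoSidedIdeal.subset_span ⟨_, rfl, rfl⟩)

theorem homog_le_arrowIdeal {n : ℕ} (hn : n ≠ 0) {x : PathAlgebra K V} (hx : x ∈ homog K V n) :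
    x ∈ arrowIdeal K V := by
  refine Submodule.span_induction (p := fun x _ => x ∈ arrowIdeal K V) ?_ ?_ ?_ ?_ hx
  · rintro _ ⟨p, hp, rfl⟩
    exact ofPath_mem_arrowIdeal (by rw [hp]; exact hn)
  · exact zero_mem _
  · intro x y _ _ hx hy
    exact add_mem hx hy
  · intro c x _ hx
    rw [Algebra.smul_def]
    exact TwoSidedIdeal.mul_mem_left _ _ _ hx

/-- The left `Λ`-module `Λ₀ = Λ/(J/I)`, as a graded module concentrated in degree `0`. -/
def Quot.degreeZero (I : TwoSidedIdeal (PathAlgebra K V)) : GradedMod (Quot.homog I) where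
  carrier := Quot I ⧸ Quot.radical I
  deg i := if i = 0 then ⊤ else ⊥
  isInternal := GradedMod.isInternal_concentrated _
  smul_mem := by
    intro i j a x ha hx
    by_cases hj : j = 0
    · subst hj
      by_cases hi : i = 0
      · subst hi
        simp
      · have h : a • x = 0 := by
          obtain ⟨b, rfl⟩ := Submodule.Quotient.mk_surjective _ x
          rw [← Submodule.Quotient.mk_smul, Submodule.Quotient.mk_eq_zero, smul_eq_mul]
          refine Quot.mul_mem_radical_right I ?_
          obtain ⟨c, hc, rfl⟩ := ha
          exact Ideal.mem_map_of_mem _ (homog_le_arrowIdeal hi hc)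
        rw [h]
        exact zero_mem _
    · rw [if_neg hj, AddSubgroup.mem_bot] at hx
      rw [hx, smul_zero]
      exact zero_mem _

/-- `Λ = KΓ/I` is `F`-determined: in a minimal graded projective resolution of `Λ₀`, each `Pⁿ` can
be generated in degree `F n`. -/
def IsDetermined (I : TwoSidedIdeal (PathAlgebra K V)) (F : ℕ → ℕ) : Prop :=
  ∃ R : MinimalGradedProjectiveResolution (Quot.radical I) (Quot.degreeZero I),
    ∀ n, (R.P n).GeneratedInDegrees {(F n : ℤ)}

/-- `Λ = KΓ/I` is weakly `F`-determined: in a minimal graded projective resolution of `Λ₀`, each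
`Pⁿ` can be generated in degrees at least `n` and at most `F n`. -/
def IsWeaklyDetermined (I : TwoSidedIdeal (PathAlgebra K V)) (F : ℕ → ℕ) : Prop :=
  ∃ R : MinimalGradedProjectiveResolution (Quot.radical I) (Quot.degreeZero I),
    ∀ n, (R.P n).GeneratedInDegrees (Set.Icc (n : ℤ) (F n : ℤ))

/-- The function `δ`, with `δ(n) = (n/2)d` for even `n` and `δ(n) = ((n-1)/2)d + 1` for
odd `n`. -/
def delta (d n : ℕ) : ℕ := if Even n then n / 2 * d else (n - 1) / 2 * d + 1

/-- `KΓ/I` is a `d`-Koszul algebra. -/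
def IsKoszul (d : ℕ) (I : TwoSidedIdeal (PathAlgebra K V)) : Prop :=
  IsDetermined I (delta d)

/-- `KΓ/I` is `2`-`d`-determined: `I` can be generated by homogeneous elements of degrees `2` and
`d`, and `KΓ/I` is weakly `δ`-determined. -/
def IsTwoDetermined (d : ℕ) (I : TwoSidedIdeal (PathAlgebra K V)) : Prop :=
  (∃ X : Set (PathAlgebra K V),
    (∀ x ∈ X, x ∈ homog K V 2 ∨ x ∈ homog K V d) ∧ TwoSidedIdeal.span X = I) ∧
  IsWeaklyDetermined I (delta d)

/-- `G` is a minimal generating set of paths of the (monomial) ideal `I`. -/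
def IsMinimalPathGenerators (G : Set (QPath V)) (I : TwoSidedIdeal (PathAlgebra K V)) : Prop :=
  Minimal (fun S : Set (QPath V) => monomialIdeal K S = I) G

end PathAlgebra

end

/-! Over a monomial algebra `Λ` with set of relations `S`, the module `Λ₀` has an explicit minimal
resolution. Its generators in homological degree `n` are chains: a vertex, then an arrow ending
there, then repeatedly a nonzero path whose product with the previous one is zero, while no proper
right factor of it has this property. The internal degree of a chain is its total length. Exactness
is combinatorial: image and kernel of the differentials are both sums, over the generators, of left
ideals spanned by killing paths (`Cells.mem_range_diff_iff`, `Cells.diff_eq_zero_iff`).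

An arbitrary minimal graded resolution is compared with this one by chain maps in both directions;
their composite on the chain resolution is the identity modulo the radical (`sub_mem_smul_top`).
Hence generation in prescribed degrees is possible exactly when all chain lengths are among them
(`exists_resolution_iff`), and both sides of the theorem become statements about chain lengths.

If `q` minimally kills an arrow `a`, then `qa` is a relation, so `q` has length `1` or `d - 1`. When
all relations have length `d`, the function `δ` demands steps of lengths `1, d - 1, 1, d - 1, …`;
this holds as soon as whatever minimally kills such a `q` is an arrow (`ArrowsKill`), and the chains
with `n = 3` force it. When quadratic relations are present too, the same condition on `𝒢_d` says
that a step of length `d - 1` is always followed by an arrow. Two consecutive steps then have total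
length at most `d`, which gives the bound `δ`. Conversely, no element of `𝒢` is a proper factor of
another, so a chain with `n = 3` for `𝒢_d` that starts with an arrow `a` and a killer `q` is also a
chain for `𝒢`, and the bound `δ(3) = d + 1` yields `ArrowsKill`. -/

noncomputable section

namespace PathAlgebra

/-! ### Paths as lists of arrows -/

section Arrows

variable {V : Type v} [Quiver.{w} V]

/-- The list of arrows of a path. -/
def arrowList {a : V} : {b : V} → Quiver.Path a b → List (Σ a b : V, a ⟶ b)
  | _, .nil => []
  | _, .cons p e => arrowList p ++ [⟨_, _, e⟩]

/-- The list of arrows of a path with arbitrary endpoints. -/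
def arrows (p : QPath V) : List (Σ a b : V, a ⟶ b) := arrowList p.2.2

theorem length_arrowList {a b : V} (p : Quiver.Path a b) : (arrowList p).length = p.length := by
  induction p with
  | nil => rfl
  | cons p e ih => simp [arrowList, ih]

theorem length_arrows (p : QPath V) : (arrows p).length = len p := length_arrowList _

theorem arrowList_comp {a b c : V} (p : Quiver.Path a b) (q : Quiver.Path b c) :
    arrowList (p.comp q) = arrowList p ++ arrowList q := by
  induction q with
  | nil => simp [arrowList]
  | cons q e ih => simp [arrowList, ih]

/-- All trivial paths share the empty list, so the list alone is not enough. Fixing the final vertex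
suffices, since each last arrow fixes the vertex before it. -/
theorem arrowList_ext {a a' b b' : V} (p : Quiver.Path a b) (q : Quiver.Path a' b')
    (h : arrowList p = arrowList q) (hb : b = b') :
    (⟨a, b, p⟩ : QPath V) = ⟨a', b', q⟩ := by
  induction p generalizing b' with
  | nil =>
    cases q with
    | nil => subst hb; rfl
    | cons q e => simp [arrowList] at h
  | cons p e ih =>
    cases q with
    | nil => simp [arrowList] at h
    | cons q e' =>
      obtain ⟨h1, h2⟩ := List.append_inj' h rfl
      simp only [List.cons.injEq, and_true, Sigma.mk.injEq] at h2
      obtain ⟨rfl, h2⟩ := h2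
      have := ih q h1 rfl
      simp only [Sigma.mk.injEq] at this
      obtain ⟨rfl, h3⟩ := this
      simp only [heq_eq_eq, Sigma.mk.injEq, true_and] at h3
      subst hb
      simp at h2
      subst h2 h3
      rfl

theorem arrows_ext {p q : QPath V} (h : arrows p = arrows q) (hb : p.2.1 = q.2.1) : p = q :=
  arrowList_ext p.2.2 q.2.2 h hb

theorem arrows_ext_of_ne_nil {p q : QPath V} (h : arrows p = arrows q) (hp : arrows p ≠ []) :
    p = q := by
  refine arrows_ext h ?_
  obtain ⟨a, b, p⟩ := p
  obtain ⟨a', b', q⟩ := q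
  cases p with
  | nil => simp [arrows, arrowList] at hp
  | cons p e =>
    cases q with
    | nil => simp [arrows, arrowList] at h
    | cons q e' =>
      obtain ⟨-, h2⟩ := List.append_inj' h rfl
      simp only [List.cons.injEq, and_true, Sigma.mk.injEq] at h2
      obtain ⟨rfl, h2⟩ := h2
      simp at h2
      exact h2.1

theorem exists_comp_of_arrowList_eq {a b : V} (p : Quiver.Path a b)
    (l₁ l₂ : List (Σ a b : V, a ⟶ b)) (h : arrowList p = l₁ ++ l₂) :
    ∃ (m : V) (p₁ : Quiver.Path a m) (p₂ : Quiver.Path m b),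
      p = p₁.comp p₂ ∧ arrowList p₁ = l₁ ∧ arrowList p₂ = l₂ := by
  induction p generalizing l₂ with
  | nil =>
    simp only [arrowList, List.nil_eq, List.append_eq_nil_iff] at h
    exact ⟨a, .nil, .nil, rfl, h.1.symm, h.2.symm⟩
  | cons p e ih =>
    rcases List.eq_nil_or_concat l₂ with rfl | ⟨l, x, rfl⟩
    · exact ⟨_, p.cons e, .nil, rfl, by simpa using h, rfl⟩
    · rw [List.concat_eq_append, ← List.append_assoc] at h
      obtain ⟨h1, h2⟩ := List.append_inj' h rfl
      obtain ⟨m, p₁, p₂, rfl, h3, h4⟩ := ih l h1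
      exact ⟨m, p₁, p₂.cons e, rfl, h3, by simp [arrowList, h4, h2]⟩

/-- The concatenation of two composable paths. -/
def catPath (p q : QPath V) (h : p.2.1 = q.1) : QPath V :=
  ⟨p.1, q.2.1, p.2.2.comp (q.2.2.cast h.symm rfl)⟩

theorem arrows_catPath (p q : QPath V) (h : p.2.1 = q.1) :
    arrows (catPath p q h) = arrows p ++ arrows q := by
  obtain ⟨a, b, p⟩ := p
  obtain ⟨b', c, q⟩ := q
  obtain rfl : b = b' := h
  exact arrowList_comp p q

theorem exists_catPath_of_arrows_eq (p : QPath V) {l₁ l₂ : List (Σ a b : V, a ⟶ b)}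
    (h : arrows p = l₁ ++ l₂) :
    ∃ (p₁ p₂ : QPath V) (h : p₁.2.1 = p₂.1), p = catPath p₁ p₂ h ∧ arrows p₁ = l₁ ∧
      arrows p₂ = l₂ ∧ p₂.2.1 = p.2.1 ∧ p₁.1 = p.1 := by
  obtain ⟨a, b, p⟩ := p
  obtain ⟨m, p₁, p₂, rfl, h1, h2⟩ := exists_comp_of_arrowList_eq p l₁ l₂ h
  exact ⟨⟨a, m, p₁⟩, ⟨m, b, p₂⟩, rfl, rfl, h1, h2, rfl, rfl⟩

theorem catPath_inj {p p' q : QPath V} {h : p.2.1 = q.1} {h' : p'.2.1 = q.1}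
    (e : catPath p q h = catPath p' q h') : p = p' := by
  refine arrows_ext ?_ (h.trans h'.symm)
  have := congrArg arrows e
  rwa [arrows_catPath, arrows_catPath, List.append_left_inj] at this

/-- The trivial path at a vertex. -/
def trivialPath (v : V) : QPath V := ⟨v, v, .nil⟩

theorem arrows_trivialPath (v : V) : arrows (trivialPath v) = [] := rfl

/-- The list `l` contains one of the paths of `S` as a contiguous sublist. -/
def HasFactorIn (S : Set (QPath V)) (l : List (Σ a b : V, a ⟶ b)) : Prop :=
  ∃ g ∈ S, arrows g <:+: l

theorem HasFactorIn.mono {S : Set (QPath V)} {l l' : List (Σ a b : V, a ⟶ b)}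
    (h : HasFactorIn S l) (hl : l <:+: l') : HasFactorIn S l' :=
  let ⟨g, hg, h⟩ := h
  ⟨g, hg, h.trans hl⟩

end Arrows

/-! ### Coefficients and membership in monomial ideals -/

section Coeff

variable {K : Type u} {V : Type v} [Field K] [Quiver.{w} V]

/-- The coefficient of a path in an element of the path algebra. -/
def coeff (x : QPath V) : PathAlgebra K V →ₗ[K] K := Finsupp.lapply x

theorem ofPath_mem_homog (p : QPath V) : ofPath K p ∈ homog K V (len p) :=
  Submodule.subset_span ⟨p, rfl, rfl⟩

theorem coeff_ofPath_self (x : QPath V) : coeff x (ofPath K x) = 1 :=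
  Finsupp.single_eq_same

theorem coeff_ofPath_of_ne {x p : QPath V} (h : x ≠ p) : coeff x (ofPath K p) = 0 :=
  Finsupp.single_eq_of_ne h

/-- An element of the path algebra whose paths all satisfy `P` lies in every additive subgroup
that contains the multiples of the paths satisfying `P`. -/
theorem mem_of_forall_coeff {P : QPath V → Prop} (N : AddSubgroup (PathAlgebra K V))
    (hN : ∀ (k : K) (p : QPath V), P p → k • ofPath K p ∈ N) (f : PathAlgebra K V)
    (hf : ∀ x, coeff x f ≠ 0 → P x) : f ∈ N := by
  have h : f = Finsupp.sum (show QPath V →₀ K from f) fun p k => k • ofPath K p := by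
    refine (Finsupp.sum_single (show QPath V →₀ K from f)).symm.trans ?_
    refine Finsupp.sum_congr fun p _ => ?_
    exact (Finsupp.smul_single_one p _).symm
  rw [h]
  exact sum_mem fun p hp => hN _ p (hf p (Finsupp.mem_support_iff.mp hp))

theorem ofPath_mul_ofPath_eq (p q : QPath V) (h : p.2.1 = q.1) :
    ofPath K p * ofPath K q = ofPath K (catPath p q h) := by
  rw [ofPath_mul_ofPath, pathMul, dif_pos h]; rfl

theorem ofPath_mul_ofPath_of_ne (p q : QPath V) (h : p.2.1 ≠ q.1) :
    ofPath K p * ofPath K q = 0 := by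
  rw [ofPath_mul_ofPath, pathMul_of_ne h]

theorem ofPath_mul_trivialPath (p : QPath V) (v : V) (h : p.2.1 = v) :
    ofPath K p * ofPath K (trivialPath v) = ofPath K p := by
  rw [ofPath_mul_ofPath_eq p (trivialPath v) h]
  congr 1
  refine arrows_ext ?_ h.symm
  exact (arrows_catPath _ _ _).trans (List.append_nil _)

theorem trivialPath_mul_ofPath (p : QPath V) (v : V) (h : p.1 = v) :
    ofPath K (trivialPath v) * ofPath K p = ofPath K p := by
  rw [ofPath_mul_ofPath_eq (trivialPath v) p h.symm]
  congr 1
  refine arrows_ext ?_ rfl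
  exact arrows_catPath _ _ _

theorem coeff_mul_ofPath (f : PathAlgebra K V) (p q : QPath V) (h : p.2.1 = q.1) :
    coeff (catPath p q h) (f * ofPath K q) = coeff p f := by
  refine induction_on (P := fun f => coeff (catPath p q h) (f * ofPath K q) = coeff p f) f
    ?_ ?_ fun c p' => ?_
  · simp [PathAlgebra.zero_mul']
  · intro f g hf hg
    simp only [PathAlgebra.add_mul', map_add, hf, hg]
  · rw [PathAlgebra.smul_mul, map_smul, map_smul]
    congr 1
    by_cases h' : p'.2.1 = q.1
    · rw [ofPath_mul_ofPath_eq _ _ h']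
      by_cases e : p = p'
      · subst e
        rw [coeff_ofPath_self, coeff_ofPath_self]
      · rw [coeff_ofPath_of_ne e, coeff_ofPath_of_ne fun e' => e (catPath_inj e')]
    · rw [ofPath_mul_ofPath_of_ne _ _ h', map_zero, coeff_ofPath_of_ne]
      rintro rfl
      exact h' h

theorem exists_of_coeff_mul_ofPath_ne_zero (f : PathAlgebra K V) (q x : QPath V)
    (hx : coeff x (f * ofPath K q) ≠ 0) :
    ∃ (p : QPath V) (h : p.2.1 = q.1), x = catPath p q h := by
  by_contra H
  push Not at H
  refine hx ?_
  refine induction_on (P := fun f => coeff x (f * ofPath K q) = 0) f ?_ ?_ fun c p => ?_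
  · simp [PathAlgebra.zero_mul']
  · intro f g hf hg
    simp only [PathAlgebra.add_mul', map_add, hf, hg, add_zero]
  · rw [PathAlgebra.smul_mul, map_smul]
    by_cases h : p.2.1 = q.1
    · rw [ofPath_mul_ofPath_eq _ _ h, coeff_ofPath_of_ne (H p h), smul_zero]
    · rw [ofPath_mul_ofPath_of_ne _ _ h, map_zero, smul_zero]

/-- Bilinearity reduces the claim to products of two paths. This is what makes the elements
supported on `P` a two-sided ideal. -/
theorem forall_coeff_mul {P : QPath V → Prop}
    (hl : ∀ p q h, P q → P (catPath p q h)) (hr : ∀ p q h, P p → P (catPath p q h))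
    (f g : PathAlgebra K V)
    (h : (∀ x, coeff x f ≠ 0 → P x) ∨ (∀ x, coeff x g ≠ 0 → P x)) :
    ∀ x, coeff x (f * g) ≠ 0 → P x := by
  let N : AddSubgroup (PathAlgebra K V) :=
    { carrier := {f | ∀ x, coeff x f ≠ 0 → P x}
      zero_mem' := fun x hx => absurd (map_zero _) hx
      add_mem' := fun {f g} hf hg x hx => by
        by_contra hP
        refine hx ?_
        rw [map_add, not_not.mp fun h => hP (hf x h), not_not.mp fun h => hP (hg x h), add_zero]
      neg_mem' := fun {f} hf x hx => hf x fun h => hx (by rw [map_neg, h, neg_zero]) }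
  have key : ∀ (k : K) (p : QPath V) (k' : K) (q : QPath V), P p ∨ P q →
      (k • ofPath K p) * (k' • ofPath K q) ∈ N := by
    intro k p k' q hpq x hx
    rw [PathAlgebra.smul_mul, PathAlgebra.mul_smul', map_smul, map_smul] at hx
    by_cases h : p.2.1 = q.1
    · rw [ofPath_mul_ofPath_eq _ _ h] at hx
      by_cases e : x = catPath p q h
      · rw [e]
        exact hpq.elim (hr p q h) (hl p q h)
      · rw [coeff_ofPath_of_ne e] at hx
        simp at hx
    · rw [ofPath_mul_ofPath_of_ne _ _ h] at hx
      simp at hx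
  have step : ∀ (k : K) (p : QPath V), (P p ∨ ∀ x, coeff x g ≠ 0 → P x) →
      (k • ofPath K p) * g ∈ N := by
    intro k p hp
    refine mem_of_forall_coeff (P := fun q => P p ∨ P q)
      (N.comap (AddMonoidHom.mk' (fun g => (k • ofPath K p) * g)
        (fun _ _ => PathAlgebra.mul_add' _ _ _))) (fun k' q h => key k p k' q h) g ?_
    exact fun x hx => hp.imp id fun h => h x hx
  refine mem_of_forall_coeff (P := fun p => P p ∨ ∀ x, coeff x g ≠ 0 → P x)
      (N.comap (AddMonoidHom.mk' (fun f => f * g)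
        (fun _ _ => PathAlgebra.add_mul' _ _ _))) (fun k p h => step k p h) f ?_
  exact fun x hx => h.imp (fun h => h x hx) id

/-- The elements supported on paths with a factor in `S` form a two-sided ideal containing the
generators; conversely each such path is a product with an element of `S` in the middle. Trivial
paths are excluded from `S` because their empty list is a factor of every list. -/
theorem mem_monomialIdeal_iff [Fintype V] {S : Set (QPath V)} (hS : ∀ g ∈ S, arrows g ≠ [])
    {f : PathAlgebra K V} :
    f ∈ monomialIdeal K S ↔ ∀ x, coeff x f ≠ 0 → HasFactorIn S (arrows x) := by
  have hl : ∀ (p q : QPath V) h, HasFactorIn S (arrows q) →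
      HasFactorIn S (arrows (catPath p q h)) := fun p q h hq =>
    hq.mono (by rw [arrows_catPath]; exact (List.suffix_append _ _).isInfix)
  have hr : ∀ (p q : QPath V) h, HasFactorIn S (arrows p) →
      HasFactorIn S (arrows (catPath p q h)) := fun p q h hq =>
    hq.mono (by rw [arrows_catPath]; exact (List.prefix_append _ _).isInfix)
  constructor
  · let N : TwoSidedIdeal (PathAlgebra K V) := TwoSidedIdeal.mk'
      {f | ∀ x, coeff x f ≠ 0 → HasFactorIn S (arrows x)}
      (fun x hx => absurd (map_zero _) hx)
      (fun {f g} hf hg x hx => by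
        by_contra hP
        refine hx ?_
        rw [map_add, not_not.mp fun h => hP (hf x h), not_not.mp fun h => hP (hg x h), add_zero])
      (fun {f} hf x hx => hf x fun h => hx (by rw [map_neg, h, neg_zero]))
      (fun {f g} hg => forall_coeff_mul hl hr f g (.inr hg))
      (fun {f g} hf => forall_coeff_mul hl hr f g (.inl hf))
    have hN : monomialIdeal K S ≤ N := by
      refine TwoSidedIdeal.span_le.mpr ?_
      rintro _ ⟨g, hg, rfl⟩
      refine (TwoSidedIdeal.mem_mk' ..).mpr fun x hx => ?_
      by_cases e : x = g
      · exact ⟨g, hg, by rw [e]⟩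
      · exact absurd (coeff_ofPath_of_ne e) hx
    exact fun hf => (TwoSidedIdeal.mem_mk' ..).mp (hN hf)
  · refine fun hf => mem_of_forall_coeff (monomialIdeal K S).asIdeal.toAddSubgroup ?_ f hf
    rintro k p ⟨g, hg, s, t, hst⟩
    obtain ⟨p₁, p₂, h, rfl, h₁, -, -, -⟩ := exists_catPath_of_arrows_eq p hst.symm
    obtain ⟨p₃, p₄, h', rfl, -, h₄, -, -⟩ := exists_catPath_of_arrows_eq p₁ h₁
    obtain rfl : p₄ = g := arrows_ext_of_ne_nil h₄ (by rw [h₄]; exact hS g hg)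
    rw [Algebra.smul_def, ← ofPath_mul_ofPath_eq, ← ofPath_mul_ofPath_eq]
    exact TwoSidedIdeal.mul_mem_left _ _ _ (TwoSidedIdeal.mul_mem_right _ _ _
      (TwoSidedIdeal.mul_mem_left _ _ _ (TwoSidedIdeal.subset_span ⟨p₄, hg, rfl⟩)))

theorem ofPath_mem_monomialIdeal_iff [Fintype V] {S : Set (QPath V)}
    (hS : ∀ g ∈ S, arrows g ≠ []) {p : QPath V} :
    ofPath K p ∈ monomialIdeal K S ↔ HasFactorIn S (arrows p) := by
  rw [mem_monomialIdeal_iff hS]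
  refine ⟨fun h => h p (by rw [coeff_ofPath_self]; exact one_ne_zero), fun h x hx => ?_⟩
  obtain rfl : x = p := by
    by_contra e
    exact hx (coeff_ofPath_of_ne e)
  exact h

theorem mem_arrowIdeal_iff [Fintype V] {f : PathAlgebra K V} :
    f ∈ arrowIdeal K V ↔ ∀ x, coeff x f ≠ 0 → arrows x ≠ [] := by
  have h1 : ∀ g ∈ {p : QPath V | len p = 1}, arrows g ≠ [] := fun g hg h => by
    have := length_arrows g
    rw [h, hg] at this
    simp at this
  constructor
  · intro hf x hx h
    obtain ⟨g, hg, hgx⟩ := (mem_monomialIdeal_iff h1).mp hf x hx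
    rw [h, List.infix_nil] at hgx
    exact h1 g hg hgx
  · refine fun hf => mem_of_forall_coeff (arrowIdeal K V).asIdeal.toAddSubgroup ?_ f hf
    intro k p hp
    rw [Algebra.smul_def]
    refine TwoSidedIdeal.mul_mem_left _ _ _ (ofPath_mem_arrowIdeal fun h => hp ?_)
    rw [← length_arrows] at h
    exact List.length_eq_zero_iff.mp h

end Coeff

end PathAlgebra

theorem DirectSum.isInternal_of_sum_eq_zero {ι M : Type*} [DecidableEq ι] [AddCommGroup M]
    (A : ι → AddSubgroup M)
    (h0 : ∀ (s : Finset ι) (x : ι → M), (∀ i, x i ∈ A i) → ∑ i ∈ s, x i = 0 → ∀ i ∈ s, x i = 0)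
    (h1 : ∀ x, x ∈ ⨆ i, A i) : DirectSum.IsInternal A := by
  constructor
  · rw [injective_iff_map_eq_zero]
    intro x hx
    classical
    rw [DirectSum.coeAddMonoidHom_eq_dfinsuppSum, DFinsupp.sum] at hx
    refine DFinsupp.ext fun i => Subtype.ext ?_
    by_cases hi : i ∈ DFinsupp.support x
    · exact h0 _ (fun i => (x i : M)) (fun i => (x i).2) hx i hi
    · rw [DFinsupp.notMem_support_iff.mp hi]
      rfl
  · intro y
    have : (⨆ i, A i) ≤ (DirectSum.coeAddMonoidHom A).range :=
      iSup_le fun i y hy => ⟨DirectSum.of (fun i => A i) i ⟨y, hy⟩, DirectSum.coeAddMonoidHom_of _ _ _⟩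
    exact this (h1 y)

theorem List.exists_minimal_suffix {α : Type*} (P : List α → Prop) (l : List α) (hl : P l) :
    ∃ l', l' <:+ l ∧ P l' ∧ ∀ l'', l'' <:+ l' → P l'' → l'' = l' := by
  induction hn : l.length using Nat.strong_induction_on generalizing l with
  | _ n ih =>
    by_cases H : ∀ l'', l'' <:+ l → P l'' → l'' = l
    · exact ⟨l, List.suffix_rfl, hl, H⟩
    · push Not at H
      obtain ⟨l₁, h1, h2, h3⟩ := H
      have : l₁.length < n := by
        refine hn ▸ lt_of_le_of_ne h1.length_le fun h => h3 (h1.eq_of_length h)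
      obtain ⟨l', h4, h5⟩ := ih _ this l₁ h2 rfl
      exact ⟨l', h4.trans h1, h5⟩

namespace PathAlgebra

/-! ### The quotient algebra: vertices, length grading, radical -/

section Quotient

variable {K : Type u} {V : Type v} [Field K] [Quiver.{w} V] [Fintype V]
  (I : TwoSidedIdeal (PathAlgebra K V))

/-- The class of a path in `KΓ/I`. -/
def Quot.path (p : QPath V) : Quot I := Quot.mk I (ofPath K p)

/-- The class of a vertex in `KΓ/I`. -/
def Quot.vertex (v : V) : Quot I := Quot.path I (trivialPath v)

variable {I}

theorem Quot.mk_eq_zero_iff {f : PathAlgebra K V} : Quot.mk I f = 0 ↔ f ∈ I := by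
  rw [TwoSidedIdeal.mem_iff, ← RingCon.eq]
  rfl

theorem Quot.path_mul_path (p q : QPath V) (h : p.2.1 = q.1) :
    Quot.path I p * Quot.path I q = Quot.path I (catPath p q h) := by
  rw [Quot.path, Quot.path, ← map_mul, ofPath_mul_ofPath_eq p q h, Quot.path]

theorem Quot.path_mul_vertex (p : QPath V) (v : V) (h : p.2.1 = v) :
    Quot.path I p * Quot.vertex I v = Quot.path I p := by
  rw [Quot.vertex, Quot.path, Quot.path, ← map_mul, ofPath_mul_trivialPath p v h]

theorem Quot.vertex_mul_path (p : QPath V) (v : V) (h : p.1 = v) :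
    Quot.vertex I v * Quot.path I p = Quot.path I p := by
  rw [Quot.vertex, Quot.path, Quot.path, ← map_mul, trivialPath_mul_ofPath p v h]

theorem Quot.path_mul_vertex_of_ne (p : QPath V) (v : V) (h : p.2.1 ≠ v) :
    Quot.path I p * Quot.vertex I v = 0 := by
  rw [Quot.vertex, Quot.path, Quot.path, ← map_mul, ofPath_mul_ofPath_of_ne _ _ h, map_zero]

theorem Quot.vertex_mul_vertex (v : V) : Quot.vertex I v * Quot.vertex I v = Quot.vertex I v :=
  Quot.path_mul_vertex _ _ rfl

/-- Right multiplication by a vertex discards all paths ending elsewhere, so only those ending at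
`v` have to be checked. -/
theorem Quot.mk_mul_vertex_mem (N : AddSubgroup (Quot I)) (v : V) (f : PathAlgebra K V)
    (h : ∀ x, coeff x f ≠ 0 → x.2.1 = v → ∀ k : K, Quot.mk I (k • ofPath K x) ∈ N) :
    Quot.mk I f * Quot.vertex I v ∈ N := by
  refine mem_of_forall_coeff
    (P := fun x => x.2.1 = v → ∀ k : K, Quot.mk I (k • ofPath K x) ∈ N)
    (N.comap ((AddMonoidHom.mulRight (Quot.vertex I v)).comp (Quot.mk I).toAddMonoidHom))
    (fun k x hx => ?_) f h
  change Quot.mk I (k • ofPath K x) * Quot.vertex I v ∈ N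
  rw [Algebra.smul_def, map_mul, mul_assoc]
  by_cases e : x.2.1 = v
  · rw [← Quot.path, Quot.path_mul_vertex x v e, Quot.path, ← map_mul, ← Algebra.smul_def]
    exact hx e k
  · rw [← Quot.path, Quot.path_mul_vertex_of_ne x v e, mul_zero]
    exact zero_mem _

theorem Quot.mk_smul_mem (N : Ideal (Quot I)) {f : PathAlgebra K V} (hf : Quot.mk I f ∈ N)
    (k : K) : Quot.mk I (k • f) ∈ N := by
  rw [Algebra.smul_def, map_mul]
  exact N.mul_mem_left _ hf

theorem len_eq_of_mem_homog {n : ℕ} {f : PathAlgebra K V} (hf : f ∈ homog K V n) (x : QPath V)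
    (hx : coeff x f ≠ 0) : len x = n := by
  by_contra H
  refine hx ?_
  refine Submodule.span_induction (p := fun f _ => coeff x f = 0) ?_ ?_ ?_ ?_ hf
  · rintro _ ⟨p, hp, rfl⟩
    exact coeff_ofPath_of_ne fun h => H (h ▸ hp)
  · simp
  · intro f g _ _ hf hg
    rw [map_add, hf, hg, add_zero]
  · intro k f _ hf
    rw [map_smul, hf, smul_zero]

theorem Quot.path_mem_homog (p : QPath V) : Quot.path I p ∈ Quot.homog I (len p) :=
  ⟨_, ofPath_mem_homog p, rfl⟩

theorem Quot.vertex_mem_homog (v : V) : Quot.vertex I v ∈ Quot.homog I 0 :=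
  Quot.path_mem_homog (trivialPath v)

theorem mul_mem_homog {i j : ℕ} {f g : PathAlgebra K V} (hf : f ∈ homog K V i)
    (hg : g ∈ homog K V j) : f * g ∈ homog K V (i + j) := by
  have hN : ∀ (p q : QPath V), len p = i → len q = j → ofPath K p * ofPath K q ∈
      homog K V (i + j) := by
    intro p q hp hq
    by_cases h : p.2.1 = q.1
    · rw [ofPath_mul_ofPath_eq _ _ h]
      convert ofPath_mem_homog (K := K) (catPath p q h) using 2
      rw [← length_arrows, arrows_catPath, List.length_append, length_arrows, length_arrows, hp, hq]
    · rw [ofPath_mul_ofPath_of_ne _ _ h]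
      exact zero_mem _
  refine Submodule.span_induction (p := fun f _ => f * g ∈ homog K V (i + j)) ?_ ?_ ?_ ?_ hf
  · rintro _ ⟨p, hp, rfl⟩
    refine Submodule.span_induction (p := fun g _ => ofPath K p * g ∈ homog K V (i + j))
      ?_ ?_ ?_ ?_ hg
    · rintro _ ⟨q, hq, rfl⟩
      exact hN p q hp hq
    · rw [mul_zero]; exact zero_mem _
    · intro f g _ _ hf hg
      rw [mul_add]; exact add_mem hf hg
    · intro k f _ hf
      rw [PathAlgebra.mul_smul']; exact Submodule.smul_mem _ _ hf
  · rw [zero_mul]; exact zero_mem _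
  · intro f g _ _ hf hg
    rw [add_mul]; exact add_mem hf hg
  · intro k f _ hf
    rw [PathAlgebra.smul_mul]; exact Submodule.smul_mem _ _ hf

theorem Quot.mul_mem_homog {i j : ℕ} {a b : Quot I} (ha : a ∈ Quot.homog I i)
    (hb : b ∈ Quot.homog I j) : a * b ∈ Quot.homog I (i + j) := by
  obtain ⟨f, hf, rfl⟩ := ha
  obtain ⟨g, hg, rfl⟩ := hb
  exact ⟨f * g, PathAlgebra.mul_mem_homog hf hg, map_mul (Quot.mk I) f g⟩

variable (I) in
/-- The length grading of `KΓ/I`, indexed by the integers. -/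
def Quot.homogInt : ℤ → AddSubgroup (Quot I)
  | .ofNat n => Quot.homog I n
  | .negSucc _ => ⊥

theorem Quot.homogInt_natCast (n : ℕ) : Quot.homogInt I n = Quot.homog I n := rfl

theorem Quot.mem_homogInt_cases {i : ℤ} {a : Quot I} (ha : a ∈ Quot.homogInt I i) :
    a = 0 ∨ ∃ n : ℕ, i = n ∧ a ∈ Quot.homog I n := by
  cases i with
  | ofNat n => exact .inr ⟨n, rfl, ha⟩
  | negSucc n => exact .inl ha

theorem Quot.mul_mem_homogInt {i : ℕ} {j : ℤ} {a b : Quot I} (ha : a ∈ Quot.homog I i)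
    (hb : b ∈ Quot.homogInt I j) : a * b ∈ Quot.homogInt I (i + j) := by
  obtain rfl | ⟨n, rfl, hb⟩ := Quot.mem_homogInt_cases hb
  · rw [mul_zero]; exact zero_mem _
  · exact Quot.mul_mem_homog ha hb

/-- Lifts of the summands are supported on paths of different lengths, so nothing cancels, and
membership in a monomial ideal is tested path by path. -/
theorem Quot.eq_zero_of_sum_eq_zero {S : Set (QPath V)} (hS : ∀ g ∈ S, arrows g ≠ [])
    (s : Finset ℤ) (x : ℤ → Quot (monomialIdeal K S))
    (hx : ∀ i, x i ∈ Quot.homogInt _ i) (h : ∑ i ∈ s, x i = 0) : ∀ i ∈ s, x i = 0 := by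
  have H : ∀ i, ∃ f : PathAlgebra K V, Quot.mk _ f = x i ∧ ∀ y, coeff y f ≠ 0 → (len y : ℤ) = i := by
    intro i
    obtain h | ⟨n, rfl, f, hf, hfx⟩ := Quot.mem_homogInt_cases (hx i)
    · exact ⟨0, by rw [map_zero, h], fun y hy => absurd (map_zero _) hy⟩
    · exact ⟨f, hfx, fun y hy => by rw [len_eq_of_mem_homog hf y hy]⟩
  choose f hf1 hf2 using H
  simp only [← hf1, ← map_sum, Quot.mk_eq_zero_iff] at h ⊢
  rw [mem_monomialIdeal_iff hS] at h
  intro i hi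
  rw [mem_monomialIdeal_iff hS]
  intro y hy
  refine h y ?_
  rw [map_sum, Finset.sum_eq_single i]
  · exact hy
  · intro j _ hj
    by_contra H
    exact hj ((hf2 j y H).symm.trans (hf2 i y hy))
  · exact fun H => absurd hi H

theorem Quot.mem_radical_iff {a : Quot I} :
    a ∈ Quot.radical I ↔ ∃ f ∈ arrowIdeal K V, Quot.mk I f = a := by
  rw [Quot.radical, Ideal.mem_map_iff_of_surjective _ (Quot.mk_surjective I)]
  rfl

theorem Quot.path_mem_radical {p : QPath V} (hp : arrows p ≠ []) :
    Quot.path I p ∈ Quot.radical I := by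
  refine Quot.mem_radical_iff.mpr ⟨_, ofPath_mem_arrowIdeal fun h => hp ?_, rfl⟩
  rw [← length_arrows] at h
  exact List.length_eq_zero_iff.mp h

theorem Quot.vertex_notMem_radical {S : Set (QPath V)} (hS : ∀ g ∈ S, arrows g ≠ []) (v : V) :
    Quot.vertex (monomialIdeal K S) v ∉ Quot.radical (monomialIdeal K S) := by
  rw [Quot.mem_radical_iff]
  rintro ⟨f, hf, h⟩
  rw [Quot.vertex, Quot.path, ← sub_eq_zero, ← map_sub, Quot.mk_eq_zero_iff,
    mem_monomialIdeal_iff hS] at h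
  have h0 : coeff (trivialPath v) f = 0 := by
    by_contra H
    exact mem_arrowIdeal_iff.mp hf _ H rfl
  obtain ⟨g, hg, hgx⟩ := h (trivialPath v) (by
    rw [map_sub, h0, coeff_ofPath_self]
    simp)
  rw [arrows_trivialPath, List.infix_nil] at hgx
  exact hS g hg hgx

end Quotient

/-! ### Graded projective modules on families of cells -/

section Free

/-- A family of generators of a graded module over a quotient of the path algebra: each generator
`c` has a degree and comes with a path, whose source is the vertex at which `c` lives. -/
structure Cells (V : Type v) [Quiver.{w} V] where
  T : Type (max v w)
  last : T → QPath V
  deg : T → ℕ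

variable {K : Type u} {V : Type v} [Field K] [Quiver.{w} V] [Fintype V]

/-- The direct sum of the modules `Λe_c`, with `c` in `X` and `e_c` the vertex at which `c`
lives. -/
def Cells.free (X : Cells V) (I : TwoSidedIdeal (PathAlgebra K V)) :
    Submodule (Quot I) (X.T →₀ Quot I) where
  carrier := {f | ∀ c, f c * Quot.vertex I (X.last c).1 = f c}
  zero_mem' c := by simp
  add_mem' {f g} hf hg c := by rw [Finsupp.add_apply, add_mul, hf, hg]
  smul_mem' a f hf c := by rw [Finsupp.smul_apply, smul_eq_mul, mul_assoc, hf]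

variable (X : Cells V) (I : TwoSidedIdeal (PathAlgebra K V))

/-- The map `Λ → Λe_c` followed by the inclusion into the sum. -/
def Cells.incl (c : X.T) : Quot I →ₗ[Quot I] X.free I where
  toFun a := ⟨Finsupp.single c (a * Quot.vertex I (X.last c).1), fun c' => by
    by_cases h : c = c'
    · subst h
      rw [Finsupp.single_eq_same, mul_assoc, Quot.vertex_mul_vertex]
    · rw [Finsupp.single_eq_of_ne' h, zero_mul]⟩
  map_add' a b := Subtype.ext <| by simp [add_mul]
  map_smul' a b := Subtype.ext <| by
    change Finsupp.single c _ = a • Finsupp.single c _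
    rw [Finsupp.smul_single, smul_eq_mul, smul_eq_mul, mul_assoc]

variable {X I}

theorem Cells.coe_incl (c : X.T) (a : Quot I) : (X.incl I c a : X.T →₀ Quot I) =
    Finsupp.single c (a * Quot.vertex I (X.last c).1) := rfl

theorem Cells.incl_eq_smul (c : X.T) (a : Quot I) : X.incl I c a = a • X.incl I c 1 := by
  rw [← map_smul, smul_eq_mul, mul_one]

theorem Cells.incl_mul_vertex (c : X.T) (a : Quot I) :
    X.incl I c (a * Quot.vertex I (X.last c).1) = X.incl I c a :=
  Subtype.ext <| by rw [coe_incl, coe_incl, mul_assoc, Quot.vertex_mul_vertex]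

theorem Cells.sum_incl (f : X.free I) :
    f = ∑ c ∈ (f : X.T →₀ Quot I).support, X.incl I c ((f : X.T →₀ Quot I) c) := by
  refine Subtype.ext ?_
  rw [AddSubmonoidClass.coe_finsetSum]
  refine (Finsupp.sum_single (f : X.T →₀ Quot I)).symm.trans (Finset.sum_congr rfl fun c _ => ?_)
  rw [coe_incl, f.2 c]

variable (X) in
/-- The linear map out of `⊕ Λe_c` with prescribed values on the generators. -/
def Cells.lift {M : Type*} [AddCommGroup M] [Module (Quot I) M] (m : X.T → M) :
    X.free I →ₗ[Quot I] M :=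
  Finsupp.linearCombination (Quot I) m ∘ₗ (X.free I).subtype

theorem Cells.lift_apply {M : Type*} [AddCommGroup M] [Module (Quot I) M] (m : X.T → M)
    (f : X.free I) : X.lift m f =
      ∑ c ∈ (f : X.T →₀ Quot I).support, (f : X.T →₀ Quot I) c • m c := rfl

theorem Cells.lift_incl {M : Type*} [AddCommGroup M] [Module (Quot I) M] (m : X.T → M)
    (c : X.T) (a : Quot I) :
    X.lift m (X.incl I c a) = (a * Quot.vertex I (X.last c).1) • m c :=
  Finsupp.linearCombination_single ..

theorem Cells.hom_ext {M : Type*} [AddCommGroup M] [Module (Quot I) M] {φ ψ : X.free I →ₗ[Quot I] M}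
    (h : ∀ c, φ (X.incl I c 1) = ψ (X.incl I c 1)) : φ = ψ := by
  refine LinearMap.ext fun f => ?_
  rw [sum_incl f, map_sum, map_sum]
  refine Finset.sum_congr rfl fun c _ => ?_
  rw [incl_eq_smul, map_smul, map_smul, h]

/-- Right multiplication by the idempotents of the cells is a retraction of the free module onto
this submodule. -/
theorem Cells.projective_free : Module.Projective (Quot I) (X.free I) := by
  refine Module.Projective.of_split (X.free I).subtype
    (Finsupp.lsum ℕ fun c => X.incl I c) (LinearMap.ext fun f => ?_)
  exact (sum_incl f).symm

theorem Cells.apply_mem_radical {f : X.free I}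
    (hf : f ∈ Quot.radical I • (⊤ : Submodule (Quot I) (X.free I))) (c : X.T) :
    (f : X.T →₀ Quot I) c ∈ Quot.radical I := by
  refine Submodule.smul_induction_on (p := fun f : X.free I =>
    (f : X.T →₀ Quot I) c ∈ Quot.radical I) hf ?_ ?_
  · intro a ha f _
    exact Quot.mul_mem_radical_right I ha
  · intro f g hf hg
    exact add_mem hf hg

/-- The homogeneous components of `⊕ Λe_c`. -/
def Cells.component (X : Cells V) (I : TwoSidedIdeal (PathAlgebra K V)) (i : ℤ) :
    AddSubgroup (X.free I) where
  carrier := {f | ∀ c, (f : X.T →₀ Quot I) c ∈ Quot.homogInt I (i - X.deg c)}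
  zero_mem' _ := zero_mem _
  add_mem' hf hg c := add_mem (hf c) (hg c)
  neg_mem' hf c := neg_mem (hf c)

theorem Cells.incl_path_mem_component (c : X.T) (p : QPath V) {i : ℤ} (hi : i = len p + X.deg c) :
    X.incl I c (Quot.path I p) ∈ X.component I i := by
  intro c'
  rw [coe_incl]
  by_cases h : c = c'
  · subst h
    rw [Finsupp.single_eq_same, hi, add_sub_cancel_right]
    rw [Quot.homogInt_natCast, ← add_zero (len p)]
    exact Quot.mul_mem_homog (Quot.path_mem_homog p) (Quot.vertex_mem_homog _)
  · rw [Finsupp.single_eq_of_ne' h]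
    exact zero_mem _

theorem Cells.incl_one_mem_component (c : X.T) : X.incl I c 1 ∈ X.component I (X.deg c) := by
  have : X.incl I c 1 = X.incl I c (Quot.path I (trivialPath (X.last c).1)) := by
    rw [← incl_mul_vertex c 1, one_mul]; rfl
  rw [this]
  exact incl_path_mem_component c _ (by simp [len, trivialPath])

theorem Cells.mem_addSubgroup (N : AddSubgroup (X.free I))
    (hN : ∀ c p (k : K), X.incl I c (Quot.mk I (k • ofPath K p)) ∈ N) (f : X.free I) : f ∈ N := by
  rw [sum_incl f]
  refine sum_mem fun c _ => ?_
  obtain ⟨g, hg⟩ := Quot.mk_surjective I ((f : X.T →₀ Quot I) c)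
  rw [← hg]
  exact mem_of_forall_coeff (P := fun _ => True)
    (N.comap ((X.incl I c).toAddMonoidHom.comp (Quot.mk I).toAddMonoidHom))
    (fun k p _ => AddSubgroup.mem_comap.mpr (hN c p k)) g fun _ _ => trivial

theorem Cells.mk_smul_ofPath (k : K) (p : QPath V) :
    Quot.mk I (k • ofPath K p) ∈ Quot.homog I (len p) :=
  ⟨_, Submodule.smul_mem _ k (ofPath_mem_homog p), rfl⟩

theorem Cells.smul_mem_component {i : ℕ} {j : ℤ} {a : Quot I} {f : X.free I}
    (ha : a ∈ Quot.homog I i) (hf : f ∈ X.component I j) : a • f ∈ X.component I (i + j) := by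
  intro c
  rw [add_sub_assoc]
  exact Quot.mul_mem_homogInt ha (hf c)

theorem Cells.isInternal_component {S : Set (QPath V)} (hS : ∀ g ∈ S, arrows g ≠ []) :
    DirectSum.IsInternal (X.component (monomialIdeal K S)) := by
  refine DirectSum.isInternal_of_sum_eq_zero _ ?_ fun f => ?_
  · intro s x hx h i hi
    refine Subtype.ext (Finsupp.ext fun c => ?_)
    have h' : ∑ i ∈ s, (x i : X.T →₀ Quot (monomialIdeal K S)) c = 0 := by
      rw [← Finsupp.finsetSum_apply, ← AddSubmonoidClass.coe_finsetSum, h]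
      rfl
    have := Quot.eq_zero_of_sum_eq_zero hS (s.map (Equiv.subRight (X.deg c : ℤ)).toEmbedding)
      (fun j => (x (j + X.deg c) : X.T →₀ Quot (monomialIdeal K S)) c)
      (fun j => by simpa using hx (j + X.deg c) c) (by simpa using h') (i - X.deg c)
      (by simpa using hi)
    simpa using this
  · refine mem_addSubgroup _ (fun c p k => ?_) f
    refine AddSubgroup.mem_iSup_of_mem ((len p : ℤ) + X.deg c) ?_
    rw [incl_eq_smul]
    exact smul_mem_component (mk_smul_ofPath k p) (incl_one_mem_component c)

/-- The graded module `⊕ Λe_c` over a monomial algebra. -/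
def Cells.gradedFree (X : Cells V) (K : Type u) [Field K] (S : Set (QPath V))
    (hS : ∀ g ∈ S, arrows g ≠ []) : GradedMod (Quot.homog (monomialIdeal K S)) where
  carrier := X.free (monomialIdeal K S)
  deg := X.component (monomialIdeal K S)
  isInternal := isInternal_component hS
  smul_mem := smul_mem_component

theorem Cells.span_component_eq_top {D : Set ℤ} (hD : ∀ c, (X.deg c : ℤ) ∈ D) :
    Submodule.span (Quot I) (⋃ i ∈ D, (X.component I i : Set (X.free I))) = ⊤ := by
  refine eq_top_iff.mpr fun f _ => ?_
  rw [sum_incl f]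
  refine Submodule.sum_mem _ fun c _ => ?_
  rw [incl_eq_smul]
  exact Submodule.smul_mem _ _
    (Submodule.subset_span (Set.mem_biUnion (hD c) (incl_one_mem_component c)))

theorem Cells.gradedFree_generatedInDegrees {S : Set (QPath V)} (hS : ∀ g ∈ S, arrows g ≠ [])
    {D : Set ℤ} (hD : ∀ c, (X.deg c : ℤ) ∈ D) : (X.gradedFree K S hS).GeneratedInDegrees D :=
  span_component_eq_top hD

theorem Cells.lift_mem_deg (M : GradedMod (Quot.homog I)) {m : X.T → M}
    (hm : ∀ c, m c ∈ M.deg (X.deg c)) {i : ℤ} {f : X.free I} (hf : f ∈ X.component I i) :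
    X.lift m f ∈ M.deg i := by
  rw [lift_apply]
  refine sum_mem fun c _ => ?_
  obtain h | ⟨n, h, h'⟩ := Quot.mem_homogInt_cases (hf c)
  · rw [h, zero_smul]
    exact zero_mem _
  · obtain rfl : i = n + X.deg c := by omega
    exact M.smul_mem h' (hm c)

end Free

end PathAlgebra

namespace PathAlgebra

/-! ### Minimal killers and chains -/

section Next

variable {V : Type v} [Quiver.{w} V] (S : Set (QPath V))

/-- The condition on a list `l` of arrows that prolonging `q` by `l` on the left gives zero modulo
the paths of `S` or, if `q` is a vertex, modulo all arrows. -/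
def Kills (q : QPath V) (l : List (Σ a b : V, a ⟶ b)) : Prop :=
  (arrows q = [] ∧ l ≠ []) ∨ (arrows q ≠ [] ∧ HasFactorIn S (l ++ arrows q))

/-- The nonzero paths that minimally kill `q` from the left. -/
def minKillers (q : QPath V) : Set (QPath V) :=
  {p | p.2.1 = q.1 ∧ ¬ HasFactorIn S (arrows p) ∧ Kills S q (arrows p) ∧
    ∀ l, l <:+ arrows p → Kills S q l → l = arrows p}

variable {S}

/-- The shortest killing right factor of `p` is a minimal killer unless it already vanishes in the
quotient. Thus minimal killers generate the left ideal of all killers. -/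
theorem exists_minimal_kills {p q : QPath V} (h : p.2.1 = q.1) (hp : Kills S q (arrows p)) :
    ∃ (p₁ p₂ : QPath V) (e : p₁.2.1 = p₂.1), p = catPath p₁ p₂ e ∧ p₂.2.1 = q.1 ∧
      (HasFactorIn S (arrows p₂) ∨ p₂ ∈ minKillers S q) := by
  obtain ⟨l, ⟨l', hl⟩, h1, h2⟩ := List.exists_minimal_suffix _ _ hp
  obtain ⟨p₁, p₂, e, rfl, -, rfl, h4, -⟩ := exists_catPath_of_arrows_eq p hl.symm
  refine ⟨p₁, p₂, e, rfl, h4.trans h, or_iff_not_imp_left.mpr fun H => ⟨h4.trans h, H, h1, h2⟩⟩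

/-- Two right factors of one path are comparable, and minimality rules out a proper inclusion. This
prevents cancellation in the differential. -/
theorem eq_of_mem_minKillers {q p₁ p₂ y₁ y₂ : QPath V} (h₁ : p₁ ∈ minKillers S q)
    (h₂ : p₂ ∈ minKillers S q) {e₁ : y₁.2.1 = p₁.1} {e₂ : y₂.2.1 = p₂.1}
    (e : catPath y₁ p₁ e₁ = catPath y₂ p₂ e₂) : p₁ = p₂ := by
  have h := congrArg arrows e
  rw [arrows_catPath, arrows_catPath] at h
  refine arrows_ext ?_ (h₁.1.trans h₂.1.symm)
  rcases List.suffix_or_suffix_of_suffix (h ▸ List.suffix_append (arrows y₁) (arrows p₁))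
    (List.suffix_append (arrows y₂) (arrows p₂)) with H | H
  · exact h₂.2.2.2 _ H h₁.2.2.1
  · exact (h₁.2.2.2 _ H h₂.2.2.1).symm

theorem arrows_ne_nil_of_mem_minKillers {p q : QPath V} (hq : ¬ HasFactorIn S (arrows q))
    (hp : p ∈ minKillers S q) : arrows p ≠ [] := by
  intro h
  rcases hp.2.2.1 with ⟨-, h'⟩ | ⟨-, h'⟩
  · exact h' h
  · rw [h] at h'
    exact hq h'

variable (S) in
/-- The cells that generate the relations between the elements of a family of cells. -/
def Cells.next (X : Cells V) : Cells V where
  T := Σ c : X.T, minKillers S (X.last c)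
  last c := c.2
  deg c := len (c.2 : QPath V) + X.deg c.1

variable (V) in
/-- The cells corresponding to the vertices. -/
def Cells.vertices : Cells V where
  T := ULift.{w} V
  last c := trivialPath c.down
  deg _ := 0

variable (S) in
/-- The cells that generate the `n`-th term of the minimal resolution of `Λ₀`. -/
def chains : ℕ → Cells V
  | 0 => Cells.vertices V
  | n + 1 => (chains n).next S

theorem not_hasFactorIn_last_chains (hS : ∀ g ∈ S, arrows g ≠ []) :
    ∀ (n : ℕ) (c : (chains S n).T), ¬ HasFactorIn S (arrows ((chains S n).last c))
  | 0, _ => fun ⟨g, hg, h⟩ => hS g hg (List.infix_nil.mp h)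
  | _ + 1, c => c.2.2.2.1

end Next

/-! ### The chain resolution and its exactness -/

section Differential

variable {K : Type u} {V : Type v} [Field K] [Quiver.{w} V] [Fintype V] {S : Set (QPath V)}

theorem Quot.path_eq_zero (hS : ∀ g ∈ S, arrows g ≠ []) {p : QPath V}
    (hp : HasFactorIn S (arrows p)) : Quot.path (monomialIdeal K S) p = 0 :=
  Quot.mk_eq_zero_iff.mpr ((ofPath_mem_monomialIdeal_iff hS).mpr hp)

variable (K S) in
/-- The left ideal generated by the paths that kill `q` from the left. -/
def killerIdeal (q : QPath V) : Ideal (Quot (monomialIdeal K S)) :=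
  Ideal.span {a | ∃ p : QPath V, p.2.1 = q.1 ∧ Kills S q (arrows p) ∧ a = Quot.path _ p}

theorem path_mem_killerIdeal {p q : QPath V} (h : p.2.1 = q.1) (hp : Kills S q (arrows p)) :
    Quot.path (monomialIdeal K S) p ∈ killerIdeal K S q :=
  Ideal.subset_span ⟨p, h, hp, rfl⟩

theorem mul_path_eq_zero_of_mem_killerIdeal (hS : ∀ g ∈ S, arrows g ≠ []) {q : QPath V}
    (hq : arrows q ≠ []) {a : Quot (monomialIdeal K S)} (ha : a ∈ killerIdeal K S q) :
    a * Quot.path _ q = 0 := by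
  refine Submodule.span_induction
    (p := fun a _ => a * Quot.path (monomialIdeal K S) q = 0) ?_ ?_ ?_ ?_ ha
  · rintro _ ⟨p, h, hp, rfl⟩
    rw [Quot.path_mul_path p q h]
    refine Quot.path_eq_zero hS ?_
    rw [arrows_catPath]
    rcases hp with ⟨h', -⟩ | ⟨-, h'⟩
    · exact absurd h' hq
    · exact h'
  · exact zero_mul _
  · intro a b _ _ ha hb
    rw [add_mul, ha, hb, add_zero]
  · intro c a _ ha
    rw [smul_eq_mul, mul_assoc, ha, mul_zero]

variable (X : Cells V)

variable (K S) in
/-- The value of the differential on a generator. -/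
def Cells.boundary (c : (X.next S).T) : X.free (monomialIdeal K S) :=
  X.incl _ c.1 (Quot.path _ c.2)

variable (K S) in
/-- The differential between the free modules on consecutive families of cells. -/
def Cells.diff : (X.next S).free (monomialIdeal K S) →ₗ[Quot (monomialIdeal K S)]
    X.free (monomialIdeal K S) :=
  (X.next S).lift (X.boundary K S)

variable {X}

theorem Cells.diff_incl (c : (X.next S).T) (a : Quot (monomialIdeal K S)) :
    X.diff K S ((X.next S).incl _ c a) = X.incl _ c.1 (a * Quot.path _ c.2) := by
  rw [diff, lift_incl, boundary, ← map_smul, smul_eq_mul, mul_assoc]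
  congr 2
  exact Quot.vertex_mul_path _ _ rfl

theorem Cells.incl_mem_range_diff (hS : ∀ g ∈ S, arrows g ≠ []) (c : X.T)
    {a : Quot (monomialIdeal K S)} (ha : a ∈ killerIdeal K S (X.last c)) :
    X.incl _ c a ∈ LinearMap.range (X.diff K S) := by
  suffices h : killerIdeal K S (X.last c) ≤
      (LinearMap.range (X.diff K S)).comap (X.incl _ c) from h ha
  refine Ideal.span_le.mpr ?_
  rintro _ ⟨p, h, hp, rfl⟩
  obtain ⟨p₁, p₂, e, rfl, -, h3⟩ := exists_minimal_kills h hp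
  rw [← Quot.path_mul_path p₁ p₂ e]
  rcases h3 with h3 | h3
  · rw [Quot.path_eq_zero hS h3, mul_zero]
    exact zero_mem _
  · exact ⟨(X.next S).incl _ ⟨c, p₂, h3⟩ (Quot.path _ p₁), diff_incl ⟨c, p₂, h3⟩ _⟩

/-- Holds because minimal killers generate the killer ideal of each cell. The kernel of the
preceding map has the same description, which is exactness. -/
theorem Cells.mem_range_diff_iff (hS : ∀ g ∈ S, arrows g ≠ [])
    {f : X.free (monomialIdeal K S)} :
    f ∈ LinearMap.range (X.diff K S) ↔
      ∀ c, (f : X.T →₀ _) c ∈ killerIdeal K S (X.last c) := by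
  constructor
  · rintro ⟨g, rfl⟩ c
    rw [diff, lift_apply, AddSubmonoidClass.coe_finsetSum, Finsupp.finsetSum_apply]
    refine sum_mem fun c' _ => ?_
    refine Ideal.mul_mem_left _ _ ?_
    rw [boundary, coe_incl]
    by_cases h : c'.1 = c
    · subst h
      rw [Finsupp.single_eq_same, Quot.path_mul_vertex _ _ c'.2.2.1]
      exact path_mem_killerIdeal c'.2.2.1 c'.2.2.2.2.1
    · rw [Finsupp.single_eq_of_ne' h]
      exact zero_mem _
  · intro h
    rw [sum_incl f]
    exact sum_mem fun c _ => incl_mem_range_diff hS c (h c)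

/-- Left multiples of different minimal killers of one path never coincide, so the terms of a
vanishing image vanish separately. The kernel is thus found one generator at a time, as the left
annihilator of a nontrivial path. -/
theorem Cells.diff_eq_zero_iff (hS : ∀ g ∈ S, arrows g ≠ [])
    (hX : ∀ c, ¬ HasFactorIn S (arrows (X.last c)))
    {f : (X.next S).free (monomialIdeal K S)} :
    X.diff K S f = 0 ↔
      ∀ c, (f : (X.next S).T →₀ Quot (monomialIdeal K S)) c ∈ killerIdeal K S ((X.next S).last c) := by
  have hne : ∀ c, arrows ((X.next S).last c) ≠ [] := fun c =>
    arrows_ne_nil_of_mem_minKillers (hX c.1) c.2.2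
  constructor
  · intro h c₀
    choose F hF using fun c => Quot.mk_surjective _ ((f : (X.next S).T →₀ Quot (monomialIdeal K S)) c)
    classical
    -- Only the cells lying over `c₀.1` contribute to that coordinate of the image.
    have hsum : ∑ c ∈ (f : (X.next S).T →₀ Quot (monomialIdeal K S)).support.filter (fun c => c.1 = c₀.1),
        F c * ofPath K c.2.1 ∈ monomialIdeal K S := by
      rw [← Quot.mk_eq_zero_iff, map_sum, Finset.sum_filter]
      have h' : (X.diff K S f : X.T →₀ Quot (monomialIdeal K S)) c₀.1 = 0 := by
        rw [h]; rfl
      rw [diff, lift_apply, AddSubmonoidClass.coe_finsetSum, Finsupp.finsetSum_apply] at h'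
      refine Eq.trans (Finset.sum_congr rfl fun c _ => ?_) h'
      change _ = (f : (X.next S).T →₀ Quot (monomialIdeal K S)) c *
        (X.boundary K S c : X.T →₀ Quot (monomialIdeal K S)) c₀.1
      rw [boundary, coe_incl]
      split_ifs with hc
      · rw [map_mul, hF, ← hc, Finsupp.single_eq_same, Quot.path_mul_vertex _ _ c.2.2.1]
        rfl
      · rw [Finsupp.single_eq_of_ne' hc, mul_zero]
    by_cases h0 : (f : (X.next S).T →₀ Quot (monomialIdeal K S)) c₀ = 0
    · rw [h0]
      exact zero_mem _
    rw [mem_monomialIdeal_iff hS] at hsum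
    rw [← f.2 c₀, ← hF c₀]
    refine Quot.mk_mul_vertex_mem (killerIdeal K S ((X.next S).last c₀)).toAddSubgroup _ _
      fun x hx hxe => ?_
    refine fun k => Quot.mk_smul_mem _ (path_mem_killerIdeal hxe ?_) k
    refine .inr ⟨hne c₀, ?_⟩
    rw [← arrows_catPath _ _ hxe]
    refine hsum _ ?_
    -- The path formed by `x` followed by the killer of `c₀` occurs in no other summand, so its
    -- coefficient is that of `x` in `F c₀`.
    rw [map_sum, Finset.sum_eq_single c₀]
    · exact (coeff_mul_ofPath (F c₀) x c₀.2.1 hxe).trans_ne hx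
    · intro c hc hne'
      by_contra H
      obtain ⟨y, hy, e⟩ := exists_of_coeff_mul_ofPath_ne_zero _ _ _ H
      obtain ⟨c₁, p⟩ := c
      obtain rfl : c₁ = c₀.1 := (Finset.mem_filter.mp hc).2
      refine hne' (Sigma.ext rfl (heq_of_eq (Subtype.ext ?_)))
      exact (eq_of_mem_minKillers c₀.2.2 p.2 e).symm
    · intro H
      exact (H (Finset.mem_filter.mpr ⟨Finsupp.mem_support_iff.mpr h0, rfl⟩)).elim
  · intro h
    rw [diff, lift_apply]
    simp only [boundary]
    refine Finset.sum_eq_zero fun c _ => ?_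
    rw [← map_smul, smul_eq_mul]
    refine (congrArg _ ?_).trans (map_zero _)
    exact mul_path_eq_zero_of_mem_killerIdeal hS (hne c) (h c)

theorem Cells.range_diff_le (hX : ∀ c, ¬ HasFactorIn S (arrows (X.last c))) :
    LinearMap.range (X.diff K S) ≤ Quot.radical (monomialIdeal K S) • ⊤ := by
  rintro _ ⟨f, rfl⟩
  rw [diff, lift_apply]
  simp only [boundary]
  refine sum_mem fun c _ => Submodule.smul_mem _ _ ?_
  rw [incl_eq_smul]
  exact Submodule.smul_mem_smul (Quot.path_mem_radical
    (arrows_ne_nil_of_mem_minKillers (hX c.1) c.2.2)) trivial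

theorem Cells.diff_mem_component {i : ℤ} {f : (X.next S).free (monomialIdeal K S)}
    (hS : ∀ g ∈ S, arrows g ≠ []) (hf : f ∈ (X.next S).component _ i) :
    X.diff K S f ∈ X.component _ i :=
  lift_mem_deg (X.gradedFree K S hS) (m := X.boundary K S)
    (fun c => incl_path_mem_component c.1 c.2.1 (Nat.cast_add ..)) hf

variable (K S) in
/-- The value of the augmentation on a generator. -/
def vertexClass (c : (Cells.vertices V).T) :
    Quot (monomialIdeal K S) ⧸ Quot.radical (monomialIdeal K S) :=
  Submodule.Quotient.mk (Quot.vertex _ c.down)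

variable (K S) in
/-- The augmentation of the resolution of `Λ₀`. -/
def augmentation : (Cells.vertices V).free (monomialIdeal K S) →ₗ[Quot (monomialIdeal K S)]
    Quot (monomialIdeal K S) ⧸ Quot.radical (monomialIdeal K S) :=
  (Cells.vertices V).lift (vertexClass K S)

theorem augmentation_surjective : Function.Surjective (augmentation K S) := by
  intro y
  obtain ⟨a, rfl⟩ := Submodule.Quotient.mk_surjective _ y
  let gen : V → (Cells.vertices.{v, w} V).T := ULift.up
  refine ⟨∑ v : V, (Cells.vertices V).incl _ (gen v) a, ?_⟩
  rw [map_sum]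
  have h : ∀ v : V, augmentation K S ((Cells.vertices V).incl _ (gen v) a) =
      a • Submodule.Quotient.mk (Quot.vertex _ v) := fun v => by
    rw [augmentation, Cells.lift_incl, vertexClass, ← Submodule.Quotient.mk_smul, ← Submodule.Quotient.mk_smul,
      smul_eq_mul, mul_assoc]
    congr 2
    exact Quot.vertex_mul_vertex v
  simp only [h]
  rw [← Finset.smul_sum]
  have h1 : ∑ v : V, Quot.vertex (monomialIdeal K S) v = 1 := by
    simp only [Quot.vertex, Quot.path, ← map_sum]
    exact map_one (Quot.mk (monomialIdeal K S))
  have h2 : ∑ v : V, (Submodule.Quotient.mk (Quot.vertex (monomialIdeal K S) v) :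
      _ ⧸ Quot.radical (monomialIdeal K S)) = Submodule.Quotient.mk 1 := by
    rw [← h1]
    exact (map_sum (Submodule.mkQ (Quot.radical (monomialIdeal K S))) _ _).symm
  rw [h2, ← Submodule.Quotient.mk_smul, smul_eq_mul, mul_one]

/-- The coordinates lie in distinct summands `Λe_v`, so each is recovered from their sum by right
multiplication with a vertex. The killers of a vertex are the nontrivial paths ending there. -/
theorem augmentation_eq_zero_iff {f : (Cells.vertices V).free (monomialIdeal K S)} :
    augmentation K S f = 0 ↔ ∀ c, (f : (Cells.vertices V).T →₀ Quot (monomialIdeal K S)) c ∈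
      killerIdeal K S ((Cells.vertices V).last c) := by
  have key : augmentation K S f = Submodule.Quotient.mk
      (∑ c ∈ (f : (Cells.vertices V).T →₀ Quot (monomialIdeal K S)).support, (f : (Cells.vertices V).T →₀ Quot (monomialIdeal K S)) c) := by
    rw [augmentation, Cells.lift_apply]
    refine Eq.trans (Finset.sum_congr rfl fun c _ => ?_)
      (map_sum (Submodule.mkQ (Quot.radical (monomialIdeal K S))) _ _).symm
    rw [vertexClass, ← Submodule.Quotient.mk_smul, smul_eq_mul]
    exact congrArg Submodule.Quotient.mk (f.2 c)
  rw [key, Submodule.Quotient.mk_eq_zero]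
  constructor
  · intro h c₀
    have h1 : (∑ c ∈ (f : (Cells.vertices V).T →₀ Quot (monomialIdeal K S)).support, (f : (Cells.vertices V).T →₀ Quot (monomialIdeal K S)) c) *
        Quot.vertex _ c₀.down = (f : (Cells.vertices V).T →₀ Quot (monomialIdeal K S)) c₀ := by
      rw [Finset.sum_mul, Finset.sum_eq_single c₀]
      · exact f.2 c₀
      · intro c _ hc
        rw [← f.2 c, mul_assoc]
        refine (congrArg _ (Quot.path_mul_vertex_of_ne _ _ fun h => hc ?_)).trans (mul_zero _)
        exact ULift.down_injective h
      · intro h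
        rw [Finsupp.notMem_support_iff.mp h, zero_mul]
    obtain ⟨g, hg, hgs⟩ := Quot.mem_radical_iff.mp h
    rw [← h1, ← hgs]
    refine Quot.mk_mul_vertex_mem (killerIdeal K S ((Cells.vertices V).last c₀)).toAddSubgroup _ _
      fun x hx hxe => fun k => Quot.mk_smul_mem _ (path_mem_killerIdeal hxe ?_) k
    exact .inl ⟨rfl, mem_arrowIdeal_iff.mp hg x hx⟩
  · intro h
    refine sum_mem fun c _ => ?_
    have : killerIdeal K S ((Cells.vertices V).last c) ≤ Quot.radical (monomialIdeal K S) := by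
      refine Ideal.span_le.mpr ?_
      rintro _ ⟨p, -, hp, rfl⟩
      refine Quot.path_mem_radical ?_
      rcases hp with ⟨-, h'⟩ | ⟨h', -⟩
      · exact h'
      · exact absurd rfl h'
    exact this (h c)

variable (K) in
/-- The minimal graded projective resolution of `Λ₀` over a monomial algebra. -/
def chainResolution (hS : ∀ g ∈ S, arrows g ≠ []) :
    MinimalGradedProjectiveResolution (Quot.radical (monomialIdeal K S))
      (Quot.degreeZero (monomialIdeal K S)) where
  P n := (chains S n).gradedFree K S hS
  projective _ := Cells.projective_free
  d n := (chains S n).diff K S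
  ε := augmentation K S
  d_deg _ _ _ hx := Cells.diff_mem_component hS hx
  ε_deg _ _ hx := Cells.lift_mem_deg (Quot.degreeZero (monomialIdeal K S))
    (m := vertexClass K S) (fun _ => trivial) hx
  ε_surjective := augmentation_surjective
  exact_zero _ := augmentation_eq_zero_iff.trans (Cells.mem_range_diff_iff hS).symm
  exact_succ n _ := (Cells.diff_eq_zero_iff hS (not_hasFactorIn_last_chains hS n)).trans
    (Cells.mem_range_diff_iff hS).symm
  minimal n := Cells.range_diff_le (not_hasFactorIn_last_chains hS n)

end Differential

end PathAlgebra

/-! ### Homogeneous components and generation in given degrees -/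

namespace GradedMod

variable {A : Type u} [Ring A] {𝒜 : ℕ → AddSubgroup A}

/-- The projection of a graded module onto a homogeneous component. -/
def proj (M : GradedMod 𝒜) (k : ℤ) : M →+ M :=
  ((M.deg k).subtype.comp (DFinsupp.evalAddMonoidHom k)).comp
    (AddEquiv.ofBijective (DirectSum.coeAddMonoidHom M.deg) M.isInternal).symm.toAddMonoidHom

variable (M : GradedMod 𝒜)

theorem proj_mem (k : ℤ) (x : M) : M.proj k x ∈ M.deg k := Subtype.prop _

theorem symm_apply_of_mem {i : ℤ} {x : M} (hx : x ∈ M.deg i) :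
    (AddEquiv.ofBijective (DirectSum.coeAddMonoidHom M.deg) M.isInternal).symm x =
      DirectSum.of (fun i => M.deg i) i ⟨x, hx⟩ := by
  rw [AddEquiv.symm_apply_eq]
  exact (DirectSum.coeAddMonoidHom_of M.deg i ⟨x, hx⟩).symm

theorem proj_of_mem {k : ℤ} {x : M} (hx : x ∈ M.deg k) : M.proj k x = x := by
  change (((AddEquiv.ofBijective _ M.isInternal).symm x) k : M) = x
  rw [symm_apply_of_mem M hx, DirectSum.of_eq_same]

theorem proj_of_mem_of_ne {k i : ℤ} {x : M} (hx : x ∈ M.deg i) (h : i ≠ k) : M.proj k x = 0 := by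
  change (((AddEquiv.ofBijective _ M.isInternal).symm x) k : M) = 0
  rw [symm_apply_of_mem M hx, DirectSum.of_eq_of_ne _ _ _ h.symm]
  rfl

theorem mem_addSubgroup (N : AddSubgroup M) (hN : ∀ i, ∀ x ∈ M.deg i, x ∈ N) (x : M) : x ∈ N := by
  obtain ⟨y, rfl⟩ := M.isInternal.2 x
  induction y using DirectSum.induction_on with
  | zero => rw [map_zero]; exact zero_mem _
  | of i y => rw [DirectSum.coeAddMonoidHom_of]; exact hN i y y.2
  | add y z hy hz => rw [map_add]; exact add_mem hy hz

theorem map_proj {N : GradedMod 𝒜} (φ : M →+ N) (j : ℤ)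
    (hφ : ∀ i, ∀ x ∈ M.deg i, φ x ∈ N.deg (j + i)) (k : ℤ) (x : M) :
    N.proj (j + k) (φ x) = φ (M.proj k x) := by
  suffices h : x ∈ ((N.proj (j + k)).comp φ).eqLocus (φ.comp (M.proj k)) from h
  refine M.mem_addSubgroup _ (fun i x hx => ?_) x
  change N.proj (j + k) (φ x) = φ (M.proj k x)
  by_cases h : i = k
  · subst h
    rw [proj_of_mem M hx, proj_of_mem N (hφ _ _ hx)]
  · rw [proj_of_mem_of_ne M hx h, map_zero,
      proj_of_mem_of_ne N (hφ _ _ hx) fun e => h (add_left_cancel e)]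

theorem proj_smul {i : ℕ} {a : A} (ha : a ∈ 𝒜 i) (k : ℤ) (x : M) :
    M.proj k (a • x) = a • M.proj (k - i) x := by
  have := M.map_proj (N := M) (DistribSMul.toAddMonoidHom M a) i
    (fun j x hx => M.smul_mem ha hx) (k - i) x
  rwa [add_sub_cancel] at this

/-- A generator has no component in a degree outside `D`. Multiplying by a scalar of degree `0`
preserves the degree of a component, and by one of positive degree lands in `J • ⊤`; so components
outside `D` always lie there. -/
theorem mem_smul_top_of_generatedInDegrees {J : Ideal A}
    (h𝒜 : ∀ a : A, a ∈ ⨆ i, 𝒜 i) (hJ : ∀ i, i ≠ 0 → ∀ a ∈ 𝒜 i, a ∈ J) {D : Set ℤ}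
    (hM : M.GeneratedInDegrees D) {k : ℤ} (hk : k ∉ D) {x : M} (hx : x ∈ M.deg k) :
    x ∈ J • (⊤ : Submodule A M) := by
  let N : AddSubgroup M :=
    { carrier := {x | ∀ k, k ∉ D → M.proj k x ∈ J • (⊤ : Submodule A M)}
      zero_mem' := fun k _ => by rw [map_zero]; exact zero_mem _
      add_mem' := fun hx hy k hk => by rw [map_add]; exact add_mem (hx k hk) (hy k hk)
      neg_mem' := fun hx k hk => by rw [map_neg]; exact neg_mem (hx k hk) }
  suffices h : ∀ x : M, x ∈ N by
    rw [← M.proj_of_mem hx]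
    exact h x k hk
  intro x
  have hx : x ∈ Submodule.span A (⋃ i ∈ D, (M.deg i : Set M)) := by
    rw [show Submodule.span A (⋃ i ∈ D, (M.deg i : Set M)) = ⊤ from hM]
    trivial
  refine Submodule.span_induction (p := fun x _ => x ∈ N) ?_ (zero_mem _)
    (fun _ _ _ _ => add_mem) (fun a x _ hx => ?_) hx
  · intro x hx k hk
    obtain ⟨i, hi, hx⟩ := Set.mem_iUnion₂.mp hx
    rw [M.proj_of_mem_of_ne hx (ne_of_mem_of_not_mem hi hk)]
    exact zero_mem _
  · suffices h : (⨆ i, 𝒜 i) ≤ N.comap (AddMonoidHom.flip (smulAddHom A M) x) from h (h𝒜 a)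
    refine iSup_le fun i a ha k hk => ?_
    change M.proj k (a • x) ∈ _
    rw [M.proj_smul ha]
    by_cases hi : i = 0
    · subst hi
      rw [Nat.cast_zero, sub_zero]
      exact Submodule.smul_mem _ _ (hx k hk)
    · exact Submodule.smul_mem_smul (hJ i hi a ha) trivial

end GradedMod

theorem Module.Projective.exists_lift {A P M N : Type*} [Ring A] [AddCommGroup P] [Module A P]
    [AddCommGroup M] [Module A M] [AddCommGroup N] [Module A N] [Module.Projective A P]
    (d : M →ₗ[A] N) (g : P →ₗ[A] N) (h : ∀ x, g x ∈ LinearMap.range d) :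
    ∃ l : P →ₗ[A] M, d ∘ₗ l = g := by
  obtain ⟨l, hl⟩ := Module.projective_lifting_property d.rangeRestrict
    (g.codRestrict (LinearMap.range d) h) d.surjective_rangeRestrict
  exact ⟨l, LinearMap.ext fun x => congrArg Subtype.val (LinearMap.congr_fun hl x)⟩

/-! ### Comparison of minimal resolutions -/

namespace MinimalGradedProjectiveResolution

variable {A : Type u} [Ring A] {𝒜 : ℕ → AddSubgroup A} {J : Ideal A} {M : GradedMod 𝒜}
  (Q R : MinimalGradedProjectiveResolution J M)

theorem d_d (n : ℕ) (x : Q.P (n + 1 + 1)) : Q.d n (Q.d (n + 1) x) = 0 :=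
  (Q.exact_succ n _).mpr ⟨x, rfl⟩

theorem ε_d (x : Q.P 1) : Q.ε (Q.d 0 x) = 0 := (Q.exact_zero _).mpr ⟨x, rfl⟩

variable {Q R}

/-- A chain map lifting the identity can be built from maps with any property `p` that is
preserved by lifting along the differential. -/
theorem exists_chainMap (p : ∀ n, (Q.P n →ₗ[A] R.P n) → Prop)
    (h0 : ∃ f, p 0 f ∧ R.ε ∘ₗ f = Q.ε)
    (h1 : ∀ n f, p n f → (∀ x, f (Q.d n x) ∈ LinearMap.range (R.d n)) →
      ∃ f', p (n + 1) f' ∧ R.d n ∘ₗ f' = f ∘ₗ Q.d n) :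
    ∃ f : ∀ n, Q.P n →ₗ[A] R.P n, (∀ n, p n (f n)) ∧ R.ε ∘ₗ f 0 = Q.ε ∧
      ∀ n, R.d n ∘ₗ f (n + 1) = f n ∘ₗ Q.d n := by
  obtain ⟨f0, hp0, he⟩ := h0
  have H0 : ∀ x, f0 (Q.d 0 x) ∈ LinearMap.range (R.d 0) := fun x => by
    refine (R.exact_zero _).mp ?_
    rw [← LinearMap.comp_apply, he, ε_d]
  have H1 : ∀ n (f : {f // p n f ∧ ∀ x, f (Q.d n x) ∈ LinearMap.range (R.d n)}),
      ∃ f' : {f // p (n + 1) f ∧ ∀ x, f (Q.d (n + 1) x) ∈ LinearMap.range (R.d (n + 1))},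
        R.d n ∘ₗ f'.1 = f.1 ∘ₗ Q.d n := by
    rintro n ⟨f, hf, hf'⟩
    obtain ⟨f', h, h'⟩ := h1 n f hf hf'
    refine ⟨⟨f', h, fun x => ?_⟩, h'⟩
    refine (R.exact_succ n _).mp ?_
    rw [← LinearMap.comp_apply, h', LinearMap.comp_apply, d_d, map_zero]
  choose F hF using H1
  let f : ∀ n, {f // p n f ∧ ∀ x, f (Q.d n x) ∈ LinearMap.range (R.d n)} :=
    fun n => Nat.rec ⟨f0, hp0, H0⟩ F n
  exact ⟨fun n => (f n).1, fun n => (f n).2.1, he, fun n => hF n (f n)⟩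

theorem exists_linear_chainMap : ∃ f : ∀ n, Q.P n →ₗ[A] R.P n, R.ε ∘ₗ f 0 = Q.ε ∧
      ∀ n, R.d n ∘ₗ f (n + 1) = f n ∘ₗ Q.d n := by
  suffices h : ∃ f : ∀ n, Q.P n →ₗ[A] R.P n, (∀ _ : ℕ, True) ∧ R.ε ∘ₗ f 0 = Q.ε ∧
      ∀ n, R.d n ∘ₗ f (n + 1) = f n ∘ₗ Q.d n from h.imp fun _ => And.right
  refine exists_chainMap (fun _ _ => True) ?_ ?_
  · have := Q.projective 0
    obtain ⟨f, hf⟩ := Module.Projective.exists_lift R.ε Q.ε fun x => R.ε_surjective _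
    exact ⟨f, trivial, hf⟩
  · intro n f _ hf
    have := Q.projective (n + 1)
    obtain ⟨f', hf'⟩ := Module.Projective.exists_lift (R.d n) (f ∘ₗ Q.d n) hf
    exact ⟨f', trivial, hf'⟩

theorem map_mem_smul_top {M N : Type*} [AddCommGroup M] [Module A M] [AddCommGroup N] [Module A N]
    (f : M →ₗ[A] N) {x : M} (hx : x ∈ J • (⊤ : Submodule A M)) :
    f x ∈ J • (⊤ : Submodule A N) := by
  have : f x ∈ (J • (⊤ : Submodule A M)).map f := Submodule.mem_map_of_mem hx
  rw [Submodule.map_smul''] at this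
  exact Submodule.smul_mono le_rfl le_top this

/-- A chain endomorphism over the identity is the identity modulo the radical. -/
theorem sub_mem_smul_top (φ : ∀ n, Q.P n →ₗ[A] Q.P n) (hε : Q.ε ∘ₗ φ 0 = Q.ε)
    (hφ : ∀ n, Q.d n ∘ₗ φ (n + 1) = φ n ∘ₗ Q.d n) (n : ℕ) (x : Q.P n) :
    φ n x - x ∈ J • (⊤ : Submodule A (Q.P n)) := by
  -- The homotopy `h` is carried through the induction: the vanishing on the image of `Q.d n` is
  -- exactly what permits the next lift.
  suffices h : ∃ h : Q.P n →ₗ[A] Q.P (n + 1), (φ n - LinearMap.id - Q.d n ∘ₗ h) ∘ₗ Q.d n = 0 ∧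
      ∀ x, φ n x - x ∈ J • (⊤ : Submodule A (Q.P n)) from h.choose_spec.2 x
  clear x
  induction n with
  | zero =>
    have := Q.projective 0
    obtain ⟨h, hh⟩ := Module.Projective.exists_lift (Q.d 0) (φ 0 - LinearMap.id) fun x => by
      refine (Q.exact_zero _).mp ?_
      have := LinearMap.congr_fun hε x
      rw [LinearMap.comp_apply] at this
      rw [LinearMap.sub_apply, map_sub, this, LinearMap.id_apply, sub_self]
    refine ⟨h, by rw [hh, sub_self, LinearMap.zero_comp], fun x => ?_⟩
    refine Q.minimal 0 ⟨h x, LinearMap.congr_fun hh x⟩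
  | succ n ih =>
    obtain ⟨h, h1, -⟩ := ih
    have := Q.projective (n + 1)
    obtain ⟨h', hh'⟩ := Module.Projective.exists_lift (Q.d (n + 1))
      (φ (n + 1) - LinearMap.id - h ∘ₗ Q.d n) fun x => by
        refine (Q.exact_succ n _).mp ?_
        have h2 := LinearMap.congr_fun (hφ n) x
        have h3 := LinearMap.congr_fun h1 x
        simp only [LinearMap.comp_apply, LinearMap.sub_apply, LinearMap.id_apply,
          LinearMap.zero_apply, map_sub] at h2 h3 ⊢
        rw [h2, h3]
    refine ⟨h', LinearMap.ext fun x => ?_, fun x => ?_⟩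
    · have h2 := LinearMap.congr_fun hh' (Q.d (n + 1) x)
      simp only [LinearMap.comp_apply, LinearMap.sub_apply, LinearMap.id_apply,
        LinearMap.zero_apply, d_d, map_zero, sub_zero] at h2 ⊢
      rw [h2, sub_self]
    · have h2 := LinearMap.congr_fun hh' x
      simp only [LinearMap.comp_apply, LinearMap.sub_apply, LinearMap.id_apply] at h2
      -- The difference is `d h' + h d`, and minimality puts both terms into the radical part.
      rw [← sub_add_cancel (φ (n + 1) x - x) (h (Q.d n x)), ← h2]
      exact add_mem (Q.minimal _ ⟨_, rfl⟩) (map_mem_smul_top h (Q.minimal n ⟨x, rfl⟩))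

end MinimalGradedProjectiveResolution

/-! ### Generator degrees of an arbitrary minimal resolution -/

namespace PathAlgebra

variable {K : Type u} {V : Type v} [Field K] [Quiver.{w} V] [Fintype V]

theorem Quot.mem_iSup_homog {I : TwoSidedIdeal (PathAlgebra K V)} (a : Quot I) :
    a ∈ ⨆ i, Quot.homog I i := by
  obtain ⟨f, rfl⟩ := Quot.mk_surjective I a
  refine mem_of_forall_coeff (P := fun _ => True)
    ((⨆ i, Quot.homog I i).comap (Quot.mk I).toAddMonoidHom) (fun k p _ => ?_) f
    fun _ _ => trivial
  exact AddSubgroup.mem_comap.mpr (AddSubgroup.mem_iSup_of_mem (len p) (Cells.mk_smul_ofPath k p))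

theorem Quot.homog_le_radical {I : TwoSidedIdeal (PathAlgebra K V)} {i : ℕ} (hi : i ≠ 0)
    {a : Quot I} (ha : a ∈ Quot.homog I i) : a ∈ Quot.radical I := by
  obtain ⟨f, hf, rfl⟩ := ha
  exact Ideal.mem_map_of_mem _ (homog_le_arrowIdeal hi hf)

/-- Graded maps out of `⊕ Λe_c` lift along graded maps. -/
theorem Cells.exists_graded_lift {I : TwoSidedIdeal (PathAlgebra K V)} {X : Cells V}
    {M N : GradedMod (Quot.homog I)} (d : M →ₗ[Quot I] N)
    (hd : ∀ i, ∀ x ∈ M.deg i, d x ∈ N.deg i) (g : X.free I →ₗ[Quot I] N)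
    (hg : ∀ i, ∀ x ∈ X.component I i, g x ∈ N.deg i) (h : ∀ x, g x ∈ LinearMap.range d) :
    ∃ l : X.free I →ₗ[Quot I] M, (∀ i, ∀ x ∈ X.component I i, l x ∈ M.deg i) ∧ d ∘ₗ l = g := by
  choose y hy using fun c => h (X.incl I c 1)
  have he : ∀ c, Quot.vertex I (X.last c).1 • X.incl I c 1 = X.incl I c 1 := fun c => by
    rw [← map_smul, smul_eq_mul, mul_one, ← incl_mul_vertex c 1, one_mul]
  -- Since `d` preserves degrees, an arbitrary preimage may be replaced by its component in the
  -- degree of the cell.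
  have hdp : ∀ c, d (M.proj (X.deg c) (y c)) = g (X.incl I c 1) := fun c => by
    have := M.map_proj d.toAddMonoidHom 0 (fun i x hx => by rw [zero_add]; exact hd i x hx)
      (X.deg c) (y c)
    rw [zero_add] at this
    refine this.symm.trans ?_
    change N.proj _ (d (y c)) = _
    rw [hy, N.proj_of_mem (hg _ _ (incl_one_mem_component c))]
  refine ⟨X.lift fun c => Quot.vertex I (X.last c).1 • M.proj (X.deg c) (y c), ?_, ?_⟩
  · intro i x hx
    refine lift_mem_deg M (fun c => ?_) hx
    have := M.smul_mem (Quot.vertex_mem_homog (I := I) (X.last c).1) (M.proj_mem (X.deg c) (y c))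
    rwa [Nat.cast_zero, zero_add] at this
  · refine hom_ext fun c => ?_
    rw [LinearMap.comp_apply, lift_incl, one_mul, ← mul_smul, Quot.vertex_mul_vertex, map_smul,
      hdp, ← map_smul, he]

/-- The terms of a minimal graded projective resolution of `Λ₀` can be generated in the degrees
given by `D` if and only if the lengths of all chains are in `D`. -/
theorem exists_resolution_iff {S : Set (QPath V)} (hS : ∀ g ∈ S, arrows g ≠ [])
    (D : ℕ → Set ℤ) :
    (∃ R : MinimalGradedProjectiveResolution (Quot.radical (monomialIdeal K S))
        (Quot.degreeZero (monomialIdeal K S)), ∀ n, (R.P n).GeneratedInDegrees (D n)) ↔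
      ∀ n (c : (chains S n).T), ((chains S n).deg c : ℤ) ∈ D n := by
  constructor
  · rintro ⟨R, hR⟩ n c
    let Q := chainResolution K hS
    obtain ⟨f, hf, hf0, hf1⟩ := MinimalGradedProjectiveResolution.exists_chainMap (Q := Q) (R := R)
      (fun n f => ∀ i, ∀ x ∈ (Q.P n).deg i, f x ∈ (R.P n).deg i)
      (Cells.exists_graded_lift (X := chains S 0) R.ε R.ε_deg Q.ε Q.ε_deg
        fun x => R.ε_surjective _)
      (fun n f hf hr => Cells.exists_graded_lift (X := chains S (n + 1)) (R.d n) (R.d_deg n)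
        (f ∘ₗ Q.d n) (fun i x hx => hf i _ (Q.d_deg n i x hx)) hr)
    -- This map back need not respect degrees; linearity is enough to preserve the radical part.
    obtain ⟨g, hg0, hg1⟩ :=
      MinimalGradedProjectiveResolution.exists_linear_chainMap (Q := R) (R := Q)
    -- If the degree of `c` is not allowed, `f` sends its generator `b` into the radical part. Then
    -- so does `g ∘ f`, which agrees with the identity modulo the radical, and a vertex would lie in
    -- the radical.
    by_contra hc
    let b : Q.P n := (chains S n).incl _ c 1
    have h1 : f n b ∈ Quot.radical (monomialIdeal K S) • (⊤ : Submodule _ (R.P n)) :=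
      (R.P n).mem_smul_top_of_generatedInDegrees Quot.mem_iSup_homog
        (fun i hi a ha => Quot.homog_le_radical hi ha) (hR n) hc
        (hf n _ b (Cells.incl_one_mem_component c))
    have h2 := MinimalGradedProjectiveResolution.sub_mem_smul_top (Q := Q) (fun n => g n ∘ₗ f n)
      (by rw [← LinearMap.comp_assoc, hg0, hf0])
      (fun n => by rw [← LinearMap.comp_assoc, hg1, LinearMap.comp_assoc, hf1,
        LinearMap.comp_assoc]) n b
    have h3 := sub_mem (MinimalGradedProjectiveResolution.map_mem_smul_top (g n) h1) h2
    rw [LinearMap.comp_apply, sub_sub_cancel] at h3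
    have h4 := Cells.apply_mem_radical (X := chains S n) (I := monomialIdeal K S) h3 c
    refine Quot.vertex_notMem_radical (K := K) hS ((chains S n).last c).1 ?_
    have h5 : ((chains S n).incl (monomialIdeal K S) c 1 :
        (chains S n).T →₀ Quot (monomialIdeal K S)) c = Quot.vertex _ ((chains S n).last c).1 := by
      rw [Cells.coe_incl, Finsupp.single_eq_same, one_mul]
    rwa [← h5]
  · exact fun h => ⟨chainResolution K hS, fun n => Cells.gradedFree_generatedInDegrees hS (h n)⟩

end PathAlgebra

namespace PathAlgebra

/-! ### Lengths of chains -/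

section Combinatorics

variable {V : Type v} [Quiver.{w} V] {S T : Set (QPath V)}

theorem HasFactorIn.mono_set {l : List (Σ a b : V, a ⟶ b)} (h : HasFactorIn S l) (hST : S ⊆ T) :
    HasFactorIn T l :=
  let ⟨g, hg, h⟩ := h
  ⟨g, hST hg, h⟩

theorem Kills.mono_set {q : QPath V} {l : List (Σ a b : V, a ⟶ b)} (h : Kills S q l)
    (hST : S ⊆ T) : Kills T q l :=
  h.imp id fun h => ⟨h.1, h.2.mono_set hST⟩

/-- A minimal left factor that creates a relation in a product is the beginning of a relation
overlapping with the right factor. -/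
theorem exists_overlap {l m : List (Σ a b : V, a ⟶ b)} (hl : ¬ HasFactorIn S l)
    (hm : ¬ HasFactorIn S m) (h : HasFactorIn S (l ++ m))
    (hmin : ∀ l', l' <:+ l → HasFactorIn S (l' ++ m) → l' = l) :
    ∃ g ∈ S, ∃ r, arrows g = l ++ r ∧ r <+: m ∧ r ≠ [] := by
  obtain ⟨g, hg, s, t, h⟩ := h
  rw [List.append_assoc, List.append_eq_append_iff] at h
  -- The relation starts inside `l` or inside `m`. In the first case minimality makes it start at
  -- the beginning of `l`; the second contradicts `hm`.
  rcases h with ⟨k, hk, hk'⟩ | ⟨k, -, hk'⟩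
  · obtain rfl : k = l := hmin k ⟨s, hk.symm⟩ ⟨g, hg, hk' ▸ (List.prefix_append _ _).isInfix⟩
    rcases List.append_eq_append_iff.mp hk' with ⟨k', hk1, -⟩ | ⟨r, hr, hr'⟩
    · exact absurd ⟨g, hg, hk1 ▸ (List.prefix_append _ _).isInfix⟩ hl
    · refine ⟨g, hg, r, hr, ⟨t, hr'.symm⟩, ?_⟩
      rintro rfl
      exact hl ⟨g, hg, by rw [hr, List.append_nil]⟩
  · exact absurd ⟨g, hg, k, t, by rw [hk', List.append_assoc]⟩ hm

theorem exists_overlap_of_mem_minKillers {p q : QPath V} (hp : p ∈ minKillers S q)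
    (hq : arrows q ≠ []) (hq' : ¬ HasFactorIn S (arrows q)) :
    ∃ g ∈ S, ∃ r, arrows g = arrows p ++ r ∧ r <+: arrows q ∧ r ≠ [] := by
  refine exists_overlap hp.2.1 hq' ?_ fun l hl h => hp.2.2.2 l hl (.inr ⟨hq, h⟩)
  exact hp.2.2.1.elim (fun h => absurd h.1 hq) And.right

/-- Killing and having a factor are monotone in the set of relations, so nonvanishing and minimality
pass to a subset; only the killing itself can be lost. -/
theorem mem_minKillers_of_subset (hST : S ⊆ T) {p q : QPath V} (hp : p ∈ minKillers T q)
    (h : Kills S q (arrows p)) : p ∈ minKillers S q :=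
  ⟨hp.1, fun h => hp.2.1 (h.mono_set hST), h, fun l hl h' => hp.2.2.2 l hl (h'.mono_set hST)⟩

theorem len_pos_iff {p : QPath V} : 0 < len p ↔ arrows p ≠ [] := by
  rw [← length_arrows, List.length_pos_iff]

theorem not_hasFactorIn_of_length_lt {n : ℕ} (hS : ∀ g ∈ S, n < len g)
    {l : List (Σ a b : V, a ⟶ b)} (hl : l.length ≤ n) : ¬ HasFactorIn S l := by
  rintro ⟨g, hg, h⟩
  have := h.length_le
  rw [length_arrows] at this
  exact absurd (hS g hg) (by omega)

theorem mem_minKillers_trivialPath_iff (hS : ∀ g ∈ S, 1 < len g) {a : QPath V} {v : V} :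
    a ∈ minKillers S (trivialPath v) ↔ a.2.1 = v ∧ len a = 1 := by
  constructor
  · rintro ⟨h1, -, h3, h4⟩
    refine ⟨h1, ?_⟩
    have hne : arrows a ≠ [] := h3.elim And.right fun h => absurd rfl h.1
    have := h4 [(arrows a).getLast hne] ⟨_, List.dropLast_append_getLast hne⟩
      (.inl ⟨rfl, by simp⟩)
    rw [← length_arrows, ← this]
    rfl
  · rintro ⟨h1, h2⟩
    have hl := length_arrows a
    refine ⟨h1, not_hasFactorIn_of_length_lt hS (by omega), .inl ⟨rfl, len_pos_iff.mp (by omega)⟩,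
      fun l hl h => hl.eq_of_length ?_⟩
    have h3 : l ≠ [] := h.elim And.right fun h => absurd rfl h.1
    have := List.length_pos_iff.mpr h3
    have := hl.length_le
    omega

/-- If `a` is an arrow and `q` minimally kills `a`, then `qa` is one of the given paths. -/
theorem exists_eq_append_of_mem_minKillers (hS : ∀ g ∈ S, 1 < len g) {a q : QPath V}
    (ha : len a = 1) (hq : q ∈ minKillers S a) : ∃ g ∈ S, arrows g = arrows q ++ arrows a := by
  have hl := length_arrows a
  obtain ⟨g, hg, r, h1, h2, h3⟩ := exists_overlap_of_mem_minKillers hq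
    (len_pos_iff.mp (by omega)) (not_hasFactorIn_of_length_lt hS (by omega))
  refine ⟨g, hg, ?_⟩
  rw [h1, h2.eq_of_length]
  have := List.length_pos_iff.mpr h3
  have := h2.length_le
  omega

theorem le_deg_chains (hS : ∀ g ∈ S, arrows g ≠ []) :
    ∀ (n : ℕ) (c : (chains S n).T), n ≤ (chains S n).deg c
  | 0, _ => Nat.zero_le _
  | n + 1, c => by
    have h1 := le_deg_chains hS n c.1
    have h2 := len_pos_iff.mpr (arrows_ne_nil_of_mem_minKillers
      (not_hasFactorIn_last_chains hS n c.1) c.2.2)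
    change n + 1 ≤ len (c.2 : QPath V) + (chains S n).deg c.1
    omega

variable (S) in
/-- Every path that minimally kills a path `q`, where `q` minimally kills an arrow, is an arrow. -/
def ArrowsKill : Prop :=
  ∀ a q p : QPath V, len a = 1 → q ∈ minKillers S a → p ∈ minKillers S q → len p = 1

/-- The first homological degree in which `ArrowsKill` becomes visible. -/
theorem exists_chain_three (hS : ∀ g ∈ S, 1 < len g) {a q p : QPath V} (ha : len a = 1)
    (hq : q ∈ minKillers S a) (hp : p ∈ minKillers S q) :
    ∃ c : (chains S 3).T, (chains S 3).deg c = len p + len q + 1 :=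
  ⟨⟨⟨⟨⟨a.2.1⟩, a, (mem_minKillers_trivialPath_iff hS).mpr ⟨rfl, ha⟩⟩, q, hq⟩, p, hp⟩, by
    change len p + (len q + (len a + 0)) = _
    omega⟩

variable {d : ℕ}

theorem delta_zero : delta d 0 = 0 := by simp [delta]

theorem delta_odd (k : ℕ) : delta d (2 * k + 1) = k * d + 1 := by
  rw [delta, if_neg (by simp), Nat.add_sub_cancel, Nat.mul_div_cancel_left k two_pos]

theorem delta_even (k : ℕ) : delta d (2 * k + 2) = (k + 1) * d := by
  rw [delta, if_pos ⟨k + 1, by ring⟩, show (2 * k + 2) / 2 = k + 1 by omega]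

theorem forall_delta {P : ℕ → Prop} (h0 : P 0) (h1 : ∀ k, P (2 * k + 1)) (h2 : ∀ k, P (2 * k + 2))
    (n : ℕ) : P n := by
  obtain ⟨k, rfl | rfl⟩ := Nat.even_or_odd' n
  · cases k with
    | zero => exact h0
    | succ k => exact h2 k
  · exact h1 k

/-- If all paths of `S` have length `d`, the chains have the lengths of a `d`-Koszul algebra if and
only if `S` satisfies the condition `ArrowsKill`. -/
theorem deg_chains_eq_delta_iff (hd : 2 < d) (hS : ∀ g ∈ S, len g = d) :
    (∀ n (c : (chains S n).T), ((chains S n).deg c : ℤ) ∈ ({(delta d n : ℤ)} : Set ℤ)) ↔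
      ArrowsKill S := by
  have hS1 : ∀ g ∈ S, 1 < len g := fun g hg => by rw [hS g hg]; omega
  have hq : ∀ {a q : QPath V}, len a = 1 → q ∈ minKillers S a → len q + 1 = d := by
    intro a q ha hq
    obtain ⟨g, hg, h⟩ := exists_eq_append_of_mem_minKillers hS1 ha hq
    have := congrArg List.length h
    rw [List.length_append, length_arrows, length_arrows, length_arrows, ha, hS g hg] at this
    exact this.symm
  constructor
  · intro h a q p ha hqa hpq
    obtain ⟨c, hc⟩ := exists_chain_three hS1 ha hqa hpq
    have h3 := h 3 c
    -- Since `q` has length `d - 1`, the chain has length `len p + d`, to be compared with `δ(3) = d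
    -- + 1`.
    rw [Set.mem_singleton_iff, hc, show delta d 3 = 1 * d + 1 from delta_odd 1] at h3
    have := hq ha hqa
    omega
  · intro h
    have step : ∀ k (c : (chains S (2 * k + 1)).T),
        len ((chains S (2 * k + 1)).last c) = 1 ∧ (chains S (2 * k + 1)).deg c = k * d + 1 := by
      intro k
      induction k with
      | zero =>
        intro c
        have := ((mem_minKillers_trivialPath_iff hS1).mp c.2.2).2
        refine ⟨this, ?_⟩
        change len (c.2 : QPath V) + 0 = _
        rw [this]
        simp
      | succ k ih =>
        intro c
        obtain ⟨h1, h2⟩ := ih c.1.1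
        have h3 := h _ _ _ h1 c.1.2.2 c.2.2
        refine ⟨h3, ?_⟩
        have h4 := hq h1 c.1.2.2
        change len (c.2 : QPath V) + (len (c.1.2 : QPath V) + (chains S (2 * k + 1)).deg c.1.1) = _
        rw [h2, h3, add_mul]
        omega
    refine forall_delta ?_ ?_ ?_
    · intro c
      rw [delta_zero]
      rfl
    · intro k c
      rw [Set.mem_singleton_iff, delta_odd, (step k c).2]
    · intro k c
      rw [Set.mem_singleton_iff, delta_even]
      have h2 := step k c.1
      have h4 := hq h2.1 c.2.2
      change ((len (c.2 : QPath V) + (chains S (2 * k + 1)).deg c.1 : ℕ) : ℤ) = _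
      rw [h2.2, add_mul]
      congr 1
      omega

/-- For an antichain `G` of paths of lengths `2` and `d`, the lengths of the chains are bounded by
`δ` if and only if the paths of length `d` satisfy the condition `ArrowsKill`. -/
theorem deg_chains_mem_Icc_iff (hd : 2 < d) {G : Set (QPath V)}
    (hG : ∀ g ∈ G, ∀ g' ∈ G, arrows g <:+: arrows g' → g = g')
    (hlen : ∀ g ∈ G, len g = 2 ∨ len g = d) :
    (∀ n (c : (chains G n).T), ((chains G n).deg c : ℤ) ∈ Set.Icc (n : ℤ) (delta d n)) ↔
      ArrowsKill {p | p ∈ G ∧ len p = d} := by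
  set H : Set (QPath V) := {p | p ∈ G ∧ len p = d}
  have hHG : H ⊆ G := fun g hg => hg.1
  have hG1 : ∀ g ∈ G, 1 < len g := fun g hg => by rcases hlen g hg with h | h <;> omega
  have hH1 : ∀ g ∈ H, 1 < len g := fun g hg => hG1 g hg.1
  have hG0 : ∀ g ∈ G, arrows g ≠ [] := fun g hg => len_pos_iff.mp (by have := hG1 g hg; omega)
  have hq : ∀ {a q : QPath V}, len a = 1 → q ∈ minKillers H a → len q + 1 = d := by
    intro a q ha hq
    obtain ⟨g, hg, h⟩ := exists_eq_append_of_mem_minKillers hH1 ha hq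
    have := congrArg List.length h
    rw [List.length_append, length_arrows, length_arrows, length_arrows, ha, hg.2] at this
    exact this.symm
  constructor
  · intro h a q p ha hqa hpq
    obtain ⟨g, hg, hgq⟩ := exists_eq_append_of_mem_minKillers hH1 ha hqa
    have hla : (arrows a).length = 1 := (length_arrows a).trans ha
    have ha0 : arrows a ≠ [] := len_pos_iff.mp (by omega)
    have hlq : (arrows q).length + 1 = d := by rw [length_arrows]; exact hq ha hqa
    have hq0 : arrows q ≠ [] := List.length_pos_iff.mp (by omega)
    -- `q` is a proper factor of the relation `g = qa`, and no element of `G` is a proper factor of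
    -- another.
    have hfq : ¬ HasFactorIn G (arrows q) := by
      rintro ⟨g', hg', hi⟩
      obtain rfl := hG g' hg' g hg.1 (hi.trans (hgq ▸ (List.prefix_append _ _).isInfix))
      have := hi.length_le
      rw [hgq, List.length_append] at this
      omega
    -- A shorter killer would place an element of `G` properly inside `g`.
    have hqa' : q ∈ minKillers G a := by
      refine ⟨hqa.1, hfq, hqa.2.2.1.mono_set hHG, fun l hl hk => ?_⟩
      obtain ⟨g', hg', hi⟩ := (hk.resolve_left fun h => ha0 h.1).2
      obtain ⟨s, hs⟩ := hl
      obtain rfl := hG g' hg' g hg.1 (hi.trans (by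
        rw [hgq, ← hs, List.append_assoc]
        exact (List.suffix_append _ _).isInfix))
      refine List.IsSuffix.eq_of_length ⟨s, hs⟩ ?_
      have h1 := hi.length_le
      have h2 := congrArg List.length hs
      rw [hgq, List.length_append, List.length_append] at h1
      rw [List.length_append] at h2
      omega
    have hpq' : p ∈ minKillers G q := by
      obtain ⟨g', hg', r, hr, hrq, hr0⟩ := exists_overlap_of_mem_minKillers hpq hq0
        fun h => hfq (h.mono_set hHG)
      have hfp : ¬ HasFactorIn G (arrows p) := by
        rintro ⟨g'', hg'', hi⟩
        obtain rfl := hG g'' hg'' g' hg'.1 (hi.trans (hr ▸ (List.prefix_append _ _).isInfix))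
        have := hi.length_le
        rw [hr, List.length_append] at this
        have := List.length_pos_iff.mpr hr0
        omega
      refine ⟨hpq.1, hfp, hpq.2.2.1.mono_set hHG, fun l hl hk => ?_⟩
      obtain ⟨l', hl', hk', hmin⟩ := List.exists_minimal_suffix
        (fun l => HasFactorIn G (l ++ arrows q)) l (hk.resolve_left fun h => hq0 h.1).2
      obtain ⟨g'', hg'', r', hr', hrq', hr0'⟩ := exists_overlap
        (fun h => hfp (h.mono (hl'.trans hl).isInfix)) hfq hk' hmin
      -- A quadratic `g''` would be the last arrow of `p` followed by the first arrow of `q`, hence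
      -- a factor of `g'`, which is impossible as `d ≠ 2`. If `g''` has length `d`, then `l'` kills
      -- `q` already for `H`, so it is all of `p`.
      rcases hlen g'' hg'' with h2 | hdd
      · exfalso
        have hl0 : l' ≠ [] := by
          rintro rfl
          exact hfq ⟨g'', hg'', by rw [hr']; exact hrq'.isInfix⟩
        have e := congrArg List.length hr'
        rw [length_arrows, h2, List.length_append] at e
        have e1 := List.length_pos_iff.mpr hl0
        have e2 := List.length_pos_iff.mpr hr0'
        have e3 := List.length_pos_iff.mpr hr0
        obtain ⟨t, rfl⟩ := List.prefix_of_prefix_length_le hrq' hrq (by omega)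
        obtain ⟨s, hs⟩ := hl'.trans hl
        obtain rfl := hG g'' hg'' g' hg'.1 ⟨s, t, by rw [hr, hr', ← hs]; simp⟩
        have := hg'.2
        omega
      · have : l' = arrows p := hpq.2.2.2 l' (hl'.trans hl) (.inr ⟨hq0, g'', ⟨hg'', hdd⟩, by
          rw [hr']
          obtain ⟨t, ht⟩ := hrq'
          exact ⟨[], t, by rw [← ht]; simp⟩⟩)
        refine hl.eq_of_length (le_antisymm hl.length_le ?_)
        rw [← this]
        exact hl'.length_le
    obtain ⟨c, hc⟩ := exists_chain_three hG1 ha hqa' hpq'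
    have h3 := (h 3 c).2
    rw [hc, show delta d 3 = 1 * d + 1 from delta_odd 1] at h3
    have := hq ha hqa
    have := len_pos_iff.mpr (arrows_ne_nil_of_mem_minKillers hfq hpq')
    omega
  · intro h
    have short : ∀ {a q : QPath V}, len a = 1 → q ∈ minKillers G a →
        len q = 1 ∨ q ∈ minKillers H a := by
      intro a q ha hqa
      obtain ⟨g, hg, hgq⟩ := exists_eq_append_of_mem_minKillers hG1 ha hqa
      rcases hlen g hg with h2 | hdd
      · left
        have := congrArg List.length hgq
        rw [List.length_append, length_arrows, length_arrows, length_arrows, ha, h2] at this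
        omega
      · right
        exact mem_minKillers_of_subset hHG hqa (.inr ⟨len_pos_iff.mp (by omega), g, ⟨hg, hdd⟩,
          by rw [hgq]⟩)
    -- A quadratic relation overlapping both `p` and `q` leaves a single arrow for `p`; one of
    -- length `d` brings `p` under `ArrowsKill`.
    have long : ∀ {a q p : QPath V}, len a = 1 → q ∈ minKillers H a →
        ¬ HasFactorIn G (arrows q) → p ∈ minKillers G q → len p = 1 := by
      intro a q p ha hqa hfq hpq
      have hq0 : arrows q ≠ [] := len_pos_iff.mp (by have := hq ha hqa; omega)
      obtain ⟨g, hg, r, hr, hrq, hr0⟩ := exists_overlap_of_mem_minKillers hpq hq0 hfq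
      rcases hlen g hg with h2 | hdd
      · have e := congrArg List.length hr
        rw [List.length_append, length_arrows, length_arrows, h2] at e
        have e1 := len_pos_iff.mpr (arrows_ne_nil_of_mem_minKillers hfq hpq)
        have e2 := List.length_pos_iff.mpr hr0
        omega
      · refine h a q p ha hqa (mem_minKillers_of_subset hHG hpq
          (.inr ⟨hq0, g, ⟨hg, hdd⟩, ?_⟩))
        rw [hr]
        obtain ⟨t, ht⟩ := hrq
        exact ⟨[], t, by rw [← ht]; simp⟩
    let IsLong : QPath V → Prop := fun q => ∃ a, len a = 1 ∧ q ∈ minKillers H a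
    -- After an arrow the bound `k * d + 2` is kept instead of `(k + 1) * d`: a step of length `d -
    -- 1` may follow, and then the total `(k + 1) * d + 1` is exactly `δ(2k + 3)`.
    have even : ∀ k, (∀ c : (chains G (2 * k + 1)).T, (chains G (2 * k + 1)).deg c ≤ k * d + 1 ∧
        (len ((chains G (2 * k + 1)).last c) = 1 ∨ IsLong ((chains G (2 * k + 1)).last c))) →
        ∀ c : (chains G (2 * k + 2)).T,
        (len ((chains G (2 * k + 2)).last c) = 1 ∧ (chains G (2 * k + 2)).deg c ≤ k * d + 2) ∨
        (IsLong ((chains G (2 * k + 2)).last c) ∧ (chains G (2 * k + 2)).deg c ≤ (k + 1) * d) := by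
      intro k hk c
      obtain ⟨h1, h2⟩ := hk c.1
      change (len (c.2 : QPath V) = 1 ∧ len (c.2 : QPath V) + _ ≤ _) ∨
        (IsLong (c.2 : QPath V) ∧ len (c.2 : QPath V) + _ ≤ _)
      have hone : len (c.2 : QPath V) = 1 → len (c.2 : QPath V) = 1 ∧
          len (c.2 : QPath V) + (chains G (2 * k + 1)).deg c.1 ≤ k * d + 2 := fun h => ⟨h, by omega⟩
      rcases h2 with h2 | ⟨a, ha, h2⟩
      · rcases short h2 c.2.2 with h3 | h3
        · exact .inl (hone h3)
        · refine .inr ⟨⟨_, h2, h3⟩, ?_⟩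
          have := hq h2 h3
          rw [add_mul]
          omega
      · exact .inl (hone (long ha h2 (not_hasFactorIn_last_chains hG0 _ c.1) c.2.2))
    have odd : ∀ k (c : (chains G (2 * k + 1)).T), (chains G (2 * k + 1)).deg c ≤ k * d + 1 ∧
        (len ((chains G (2 * k + 1)).last c) = 1 ∨ IsLong ((chains G (2 * k + 1)).last c)) := by
      intro k
      induction k with
      | zero =>
        intro c
        have := ((mem_minKillers_trivialPath_iff hG1).mp c.2.2).2
        refine ⟨?_, .inl this⟩
        change len (c.2 : QPath V) + 0 ≤ _
        omega
      | succ k ih =>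
        intro c
        change len (c.2 : QPath V) + (chains G (2 * k + 2)).deg c.1 ≤ _ ∧
          (len (c.2 : QPath V) = 1 ∨ IsLong (c.2 : QPath V))
        rcases even k ih c.1 with ⟨h1, h2⟩ | ⟨⟨a, ha, h1⟩, h2⟩
        · rcases short h1 c.2.2 with h3 | h3
          · refine ⟨?_, .inl h3⟩
            rw [add_mul]
            omega
          · refine ⟨?_, .inr ⟨_, h1, h3⟩⟩
            have := hq h1 h3
            rw [add_mul]
            omega
        · have := long ha h1 (not_hasFactorIn_last_chains hG0 _ c.1) c.2.2
          exact ⟨by omega, .inl this⟩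
    have bound : ∀ n (c : (chains G n).T), (chains G n).deg c ≤ delta d n := by
      refine forall_delta ?_ ?_ ?_
      · exact fun c => Nat.zero_le _
      · intro k c
        rw [delta_odd]
        exact (odd k c).1
      · intro k c
        rw [delta_even]
        rcases even k (odd k) c with ⟨-, h2⟩ | ⟨-, h2⟩
        · rw [add_mul]
          omega
        · exact h2
    exact fun n c => ⟨Nat.cast_le.mpr (le_deg_chains hG0 n c), Nat.cast_le.mpr (bound n c)⟩

end Combinatorics

/-! ### Minimal generating sets of paths -/

section Minimal

variable {K : Type u} {V : Type v} [Field K] [Quiver.{w} V] [Fintype V]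

/-- If `g` were a proper factor of `g'`, then `g'` would be redundant: removing it leaves the ideal
unchanged, against minimality. -/
theorem IsMinimalPathGenerators.eq_of_infix {I : TwoSidedIdeal (PathAlgebra K V)}
    {G : Set (QPath V)} (hG : IsMinimalPathGenerators G I) (hG0 : ∀ g ∈ G, arrows g ≠ [])
    {g g' : QPath V} (hg : g ∈ G) (hg' : g' ∈ G) (h : arrows g <:+: arrows g') : g = g' := by
  by_contra hne
  have hI : monomialIdeal K G = I := hG.1
  have : monomialIdeal K (G \ {g'}) = I := by
    refine le_antisymm ?_ ?_
    · rw [← hI]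
      exact TwoSidedIdeal.span_mono (Set.image_mono Set.sdiff_subset)
    · rw [← hI]
      refine TwoSidedIdeal.span_le.mpr ?_
      rintro _ ⟨p, hp, rfl⟩
      refine (ofPath_mem_monomialIdeal_iff fun x hx => hG0 x hx.1).mpr ?_
      by_cases e : p = g'
      · subst e
        exact ⟨g, ⟨hg, hne⟩, h⟩
      · exact ⟨p, ⟨hp, e⟩, List.infix_rfl⟩
  exact (hG.2 this Set.sdiff_subset hg').2 rfl

end Minimal

end PathAlgebra

theorem theorem14 {K : Type u} [Field K] {V : Type v} [Quiver.{w} V] [Fintype V]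
    [∀ a b : V, Finite (a ⟶ b)] (d : ℕ) (hd : 2 < d)
    (I : TwoSidedIdeal (PathAlgebra K V)) (G : Set (QPath V))
    (hG : PathAlgebra.IsMinimalPathGenerators G I)
    (hlen : ∀ p ∈ G, PathAlgebra.len p = 2 ∨ PathAlgebra.len p = d) :
    PathAlgebra.IsTwoDetermined d I ↔
      PathAlgebra.IsKoszul d
        (PathAlgebra.monomialIdeal K {p : QPath V | p ∈ G ∧ PathAlgebra.len p = d}) := by
  have hG0 : ∀ g ∈ G, PathAlgebra.arrows g ≠ [] := fun g hg => PathAlgebra.len_pos_iff.mp (by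
    rcases hlen g hg with h | h <;> omega)
  have hanti := fun g hg g' hg' h => hG.eq_of_infix hG0 (g := g) (g' := g') hg hg' h
  obtain rfl : PathAlgebra.monomialIdeal K G = I := hG.1
  rw [PathAlgebra.IsKoszul, PathAlgebra.IsDetermined,
    PathAlgebra.exists_resolution_iff (fun g hg => hG0 g hg.1),
    PathAlgebra.deg_chains_eq_delta_iff hd fun g hg => hg.2,
    ← PathAlgebra.deg_chains_mem_Icc_iff hd hanti hlen,
    PathAlgebra.IsTwoDetermined, PathAlgebra.IsWeaklyDetermined,
    PathAlgebra.exists_resolution_iff hG0]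
  -- Generation in degrees `2` and `d` is automatic, with `G` itself as the generating set.
  refine and_iff_right ⟨PathAlgebra.ofPath K '' G, ?_, rfl⟩
  rintro _ ⟨p, hp, rfl⟩
  refine (hlen p hp).imp (fun h => ?_) fun h => ?_
  · exact h ▸ PathAlgebra.ofPath_mem_homog p
  · exact h ▸ PathAlgebra.ofPath_mem_homog p

end
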